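/- Let $\sigma_1=\begin{pmatrix}0&1\\1&0\end{pmatrix}$, $\sigma_2=\begin{pmatrix}0&-i\\i&0\end{pmatrix}$, $\sigma_3=\begin{pmatrix}1&0\\0&-1\end{pmatrix}$ and $\alpha_j=\begin{pmatrix}0&\sigma_j\\\sigma_j&0\end{pmatrix}$ for $j=1,2,3$. Let $d\in\{2,3\}$, let $\eta:\mathbb R\to\mathbb R$ be continuous, let $k\in\mathbb R^d$ be a unit vector, and put $q(x)=\eta(x\cdot k)$ for $x\in\mathbb R^d$. Consider the massless Dirac operators $$H_2=-i\sum_{j=1}^{2}\sigma_j\frac{\partial}{\partial x_j}+q\ \text{ in } L^2(\mathbb R^2;\mathbb C^2),\qquad H_3=-i\sum_{j=1}^{3}\alpha_j\frac{\partial}{\partial x_j}+q\ \text{ in } L^2(\mathbb R^3;\mathbb C^4),$$ with domain $H^1(\mathbb R^d;\mathbb C^{2^{d-1}})\cap\mathrm{Dom}(q)$, where $\mathrm{Dom}(q)=\{f\in L^2(\mathbb R^d;\mathbb C^{2^{d-1}}): qf\in L^2(\mathbb R^d;\mathbb C^{2^{d-1}})\}$. Then $H_d$ is essentially self-adjoint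 on this domain, so that it has exactly one self-adjoint extension, and the spectrum of this self-adjoint extension is all of $\mathbb R$. -/

import Mathlib

open MeasureTheory
open scoped SchwartzMap LineDeriv

noncomputable section

/-- The Hilbert space `L²(ℝᵈ; ℂⁿ)`. -/
abbrev SpinorL2 (d n : ℕ) : Type :=
  Lp (EuclideanSpace ℂ (Fin n)) 2 (volume : Measure (EuclideanSpace ℝ (Fin d)))

/-- The embedding of `L²(ℝᵈ; ℂⁿ)` into the tempered distributions is injective. -/
theorem SpinorL2.toTemperedDistribution_injective {d n : ℕ} :
    Function.Injective
      (Lp.toTemperedDistributionCLM (EuclideanSpace ℂ (Fin n))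
        (volume : Measure (EuclideanSpace ℝ (Fin d))) 2) :=
  LinearMap.ker_eq_bot.mp (Lp.ker_toTemperedDistributionCLM_eq_bot ..)

/-- The Sobolev space `H¹(ℝᵈ; ℂⁿ)`, as a subspace of `L²(ℝᵈ; ℂⁿ)`. -/
def sobolevH1 (d n : ℕ) : Submodule ℂ (SpinorL2 d n) where
  carrier := {f | TemperedDistribution.MemSobolev 1 2
    (f : 𝓢'(EuclideanSpace ℝ (Fin d), EuclideanSpace ℂ (Fin n)))}
  add_mem' {f g} hf hg := by
    have h := TemperedDistribution.MemSobolev.add hf hg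
    rw [← Lp.toTemperedDistributionCLM_apply, ← Lp.toTemperedDistributionCLM_apply,
      ← map_add, Lp.toTemperedDistributionCLM_apply] at h
    exact h
  zero_mem' := by
    have h := TemperedDistribution.memSobolev_fun_zero (EuclideanSpace ℝ (Fin d))
      (EuclideanSpace ℂ (Fin n)) 1 2
    rw [← map_zero (Lp.toTemperedDistributionCLM (EuclideanSpace ℂ (Fin n))
      (volume : Measure (EuclideanSpace ℝ (Fin d))) 2), Lp.toTemperedDistributionCLM_apply] at h
    exact h
  smul_mem' c {f} hf := by
    have h := TemperedDistribution.MemSobolev.smul c hf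
    rw [← Lp.toTemperedDistributionCLM_apply, ← map_smul,
      Lp.toTemperedDistributionCLM_apply] at h
    exact h

/-- The distributional partial derivatives of an `H¹` function are `L²` functions. -/
theorem exists_partialDeriv {d n : ℕ} (j : Fin d) (f : sobolevH1 d n) :
    ∃ g : SpinorL2 d n, (g : 𝓢'(EuclideanSpace ℝ (Fin d), EuclideanSpace ℂ (Fin n))) =
      ∂_{EuclideanSpace.single j (1 : ℝ)}
        ((f : SpinorL2 d n) : 𝓢'(EuclideanSpace ℝ (Fin d), EuclideanSpace ℂ (Fin n))) := by
  have h := TemperedDistribution.MemSobolev.lineDerivOp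
    (m := EuclideanSpace.single j (1 : ℝ)) f.2
  rw [sub_self, TemperedDistribution.memSobolev_zero_iff] at h
  obtain ⟨g, hg⟩ := h
  exact ⟨g, hg.symm⟩

/-- The distributional partial derivative `∂/∂xⱼ : H¹(ℝᵈ; ℂⁿ) → L²(ℝᵈ; ℂⁿ)`; it is characterized
by `partialDeriv_spec`. -/
def partialDeriv {d n : ℕ} (j : Fin d) : sobolevH1 d n →ₗ[ℂ] SpinorL2 d n where
  toFun f := (exists_partialDeriv j f).choose
  map_add' f g := by
    apply SpinorL2.toTemperedDistribution_injective
    simp only [map_add, Lp.toTemperedDistributionCLM_apply, (exists_partialDeriv j _).choose_spec]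
    rw [← LineDeriv.lineDerivOp_add]
    simp only [← Lp.toTemperedDistributionCLM_apply, Submodule.coe_add, map_add]
  map_smul' c f := by
    apply SpinorL2.toTemperedDistribution_injective
    simp only [map_smul, RingHom.id_apply, Lp.toTemperedDistributionCLM_apply,
      (exists_partialDeriv j _).choose_spec]
    rw [← LineDeriv.lineDerivOp_smul]
    simp only [← Lp.toTemperedDistributionCLM_apply, Submodule.coe_smul, map_smul]

theorem partialDeriv_spec {d n : ℕ} (j : Fin d) (f : sobolevH1 d n) :
    ((partialDeriv j f : SpinorL2 d n) :
      𝓢'(EuclideanSpace ℝ (Fin d), EuclideanSpace ℂ (Fin n))) =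
      ∂_{EuclideanSpace.single j (1 : ℝ)}
        ((f : SpinorL2 d n) : 𝓢'(EuclideanSpace ℝ (Fin d), EuclideanSpace ℂ (Fin n))) :=
  (exists_partialDeriv j f).choose_spec

/-- The domain `Dom(q) = {f ∈ L² : q f ∈ L²}` of the maximal operator of multiplication by `q`. -/
def potentialDomain {d : ℕ} (n : ℕ) (q : EuclideanSpace ℝ (Fin d) → ℝ) :
    Submodule ℂ (SpinorL2 d n) where
  carrier := {f | MemLp (fun x => (q x : ℂ) • f x) 2 volume}
  add_mem' {f g} hf hg := by
    refine (MemLp.add hf hg).ae_eq ?_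
    filter_upwards [Lp.coeFn_add f g] with x hx
    rw [hx, Pi.add_apply, Pi.add_apply, smul_add]
  zero_mem' := by
    refine (MemLp.zero (ε := EuclideanSpace ℂ (Fin n))).ae_eq ?_
    filter_upwards [Lp.coeFn_zero (EuclideanSpace ℂ (Fin n)) 2
      (volume : Measure (EuclideanSpace ℝ (Fin d)))] with x hx
    rw [hx, Pi.zero_apply, smul_zero]
  smul_mem' c {f} hf := by
    refine (MemLp.const_smul hf c).ae_eq ?_
    filter_upwards [Lp.coeFn_smul c f] with x hx
    simp only [hx, Pi.smul_apply]
    rw [smul_comm]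

/-- Multiplication by `q`, as a linear map `Dom(q) → L²`. -/
def potentialMul {d : ℕ} (n : ℕ) (q : EuclideanSpace ℝ (Fin d) → ℝ) :
    potentialDomain n q →ₗ[ℂ] SpinorL2 d n where
  toFun f := MemLp.toLp (fun x => (q x : ℂ) • (f : SpinorL2 d n) x) f.2
  map_add' f g := by
    refine (MemLp.toLp_eq_toLp_iff (f + g).2 (MemLp.add f.2 g.2)).mpr ?_
    filter_upwards [Lp.coeFn_add (f : SpinorL2 d n) g] with x hx
    rw [Submodule.coe_add, hx, Pi.add_apply, Pi.add_apply, smul_add]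
  map_smul' c f := by
    refine (MemLp.toLp_eq_toLp_iff (c • f).2 (MemLp.const_smul f.2 c)).mpr ?_
    filter_upwards [Lp.coeFn_smul c (f : SpinorL2 d n)] with x hx
    rw [Submodule.coe_smul, hx, Pi.smul_apply, Pi.smul_apply, smul_comm]

/-- The pointwise action of a constant matrix on `L²(ℝᵈ; ℂⁿ)`. -/
def matrixAct {d n : ℕ} (M : Matrix (Fin n) (Fin n) ℂ) : SpinorL2 d n →L[ℂ] SpinorL2 d n :=
  (Matrix.toEuclideanCLM (𝕜 := ℂ) M).compLpL 2 volume

/-- The linear map `f ↦ -i ∑ⱼ γⱼ ∂f/∂xⱼ + q f` from `H¹(ℝᵈ; ℂⁿ) ∩ Dom(q)` to `L²(ℝᵈ; ℂⁿ)`. -/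
def diracMap {d n : ℕ} (γ : Fin d → Matrix (Fin n) (Fin n) ℂ)
    (q : EuclideanSpace ℝ (Fin d) → ℝ) :
    ↥(sobolevH1 d n ⊓ potentialDomain n q) →ₗ[ℂ] SpinorL2 d n :=
  (-Complex.I) • (∑ j : Fin d, (matrixAct (γ j)).toLinearMap ∘ₗ partialDeriv j ∘ₗ
      Submodule.inclusion inf_le_left)
    + potentialMul n q ∘ₗ Submodule.inclusion inf_le_right

theorem diracMap_apply {d n : ℕ} (γ : Fin d → Matrix (Fin n) (Fin n) ℂ)
    (q : EuclideanSpace ℝ (Fin d) → ℝ) (f : ↥(sobolevH1 d n ⊓ potentialDomain n q)) :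
    diracMap γ q f =
      (-Complex.I) • (∑ j : Fin d, matrixAct (γ j) (partialDeriv j ⟨f, f.2.1⟩))
        + potentialMul n q ⟨f, f.2.2⟩ := by
  simp only [diracMap, LinearMap.add_apply, LinearMap.smul_apply, LinearMap.sum_apply,
    LinearMap.comp_apply]
  rfl

/-- The operator `-i ∑ⱼ γⱼ ∂/∂xⱼ + q` in `L²(ℝᵈ; ℂⁿ)` with domain `H¹(ℝᵈ; ℂⁿ) ∩ Dom(q)`. -/
def diracOperator {d n : ℕ} (γ : Fin d → Matrix (Fin n) (Fin n) ℂ)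
    (q : EuclideanSpace ℝ (Fin d) → ℝ) : SpinorL2 d n →ₗ.[ℂ] SpinorL2 d n where
  domain := sobolevH1 d n ⊓ potentialDomain n q
  toFun := diracMap γ q

theorem diracOperator_apply {d n : ℕ} (γ : Fin d → Matrix (Fin n) (Fin n) ℂ)
    (q : EuclideanSpace ℝ (Fin d) → ℝ) (f : (diracOperator γ q).domain) :
    diracOperator γ q f =
      (-Complex.I) • (∑ j : Fin d, matrixAct (γ j) (partialDeriv j ⟨f, f.2.1⟩))
        + potentialMul n q ⟨f, f.2.2⟩ :=
  diracMap_apply γ q f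

/-- The Pauli matrices `σ₁, σ₂, σ₃`. -/
def pauli : Fin 3 → Matrix (Fin 2) (Fin 2) ℂ :=
  ![!![0, 1; 1, 0], !![0, -Complex.I; Complex.I, 0], !![1, 0; 0, -1]]

/-- The `4 × 4` Dirac matrices `α₁, α₂, α₃`. -/
def diracAlpha (j : Fin 3) : Matrix (Fin 4) (Fin 4) ℂ :=
  Matrix.reindex finSumFinEquiv finSumFinEquiv (Matrix.fromBlocks 0 (pauli j) (pauli j) 0)

/-- The massless Dirac operator `H₂ = -i σ·∇ + q` in `L²(ℝ²; ℂ²)`, on `H¹ ∩ Dom(q)`. -/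
def diracH2 (q : EuclideanSpace ℝ (Fin 2) → ℝ) : SpinorL2 2 2 →ₗ.[ℂ] SpinorL2 2 2 :=
  diracOperator ![pauli 0, pauli 1] q

/-- The massless Dirac operator `H₃ = -i α·∇ + q` in `L²(ℝ³; ℂ⁴)`, on `H¹ ∩ Dom(q)`. -/
def diracH3 (q : EuclideanSpace ℝ (Fin 3) → ℝ) : SpinorL2 3 4 →ₗ.[ℂ] SpinorL2 3 4 :=
  diracOperator diracAlpha q

section Unbounded

variable {H : Type*} [NormedAddCommGroup H] [InnerProductSpace ℂ H]

/-- The spectrum of an unbounded operator `A`: the complement of the set of all `z` for which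
`A - z : Dom(A) → H` has a bounded everywhere defined two-sided inverse `R`. -/
def unboundedSpectrum (A : H →ₗ.[ℂ] H) : Set ℂ :=
  {z | ¬ ∃ R : H →L[ℂ] H,
    (∀ x : A.domain, R (A x - z • (x : H)) = x) ∧
    ∀ y : H, ∃ x : A.domain, (x : H) = R y ∧ A x - z • (x : H) = y}

/-- A densely defined symmetric operator is essentially self-adjoint if its closure is
self-adjoint. -/
structure IsEssentiallySelfAdjoint [CompleteSpace H] (T : H →ₗ.[ℂ] H) : Prop where
  dense_domain : Dense (T.domain : Set H)
  symmetric : T.IsFormalAdjoint T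
  selfAdjoint_closure : IsSelfAdjoint T.closure

end Unbounded

end

/-! Two algebraic facts carry everything: the matrices γⱼ are Hermitian, and they anticommute with
square one, so that D = ∑ γⱼ∂ⱼ satisfies D² = Δ.

Essential self-adjointness: by the basic criterion (`isEssentiallySelfAdjoint_of_ker_eq_bot`) it
suffices that a vector u orthogonal to the range of H - z, with Im z = ±1, vanishes. For a compactly
supported cutoff φ, the function φu solves (H - z̄)(φu) = -i ∑ (∂ⱼφ)γⱼu weakly
(`diracOperator_compactMul`). Hence D(φu) is in L², Δ(φu) is in H⁻¹, and φu is in H¹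
(`mem_sobolevH1_of_dirac`); it is in Dom(q) because q is bounded on the support of φ. Symmetry now
bounds ‖φu‖ by the norm of the right-hand side, which is O(1/N) for φ = χ(·/N), and u = 0 follows as
N → ∞. No growth condition on q is needed, since the commutator of H with φ does not involve q.

Spectrum: the matrix ∑ kⱼγⱼ squares to one, so it has an eigenvector v with eigenvalue s = ±1. If g'
= t - η, then exp(i s g(x·k)) v solves (H - t)f = 0 exactly: a potential depending on x·k alone can
be gauged away. Multiplying by χ(x/N) gives a squared norm of order N^d and a squared residual of
order at most N^(d-2), hence approximate eigenfunctions for every real t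
(`exists_approximate_eigenfunction`). Non-real points are excluded by self-adjointness. -/

namespace LinearPMap

/-! ### Symmetric operators: the self-adjointness criterion and the spectrum -/

section Unbounded

variable {H : Type*} [NormedAddCommGroup H] [InnerProductSpace ℂ H]

theorem IsFormalAdjoint.im_inner_self_eq_zero {S : H →ₗ.[ℂ] H} (hS : S.IsFormalAdjoint S)
    (x : S.domain) : (inner ℂ (x : H) (S x)).im = 0 := by
  have h := congrArg Complex.im (hS x x)
  rw [← inner_conj_symm, Complex.conj_im] at h
  linarith

/-- For a symmetric operator `S`, `|Im z| ‖x‖ ≤ ‖(S - z) x‖`. -/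
theorem IsFormalAdjoint.abs_im_mul_norm_le {S : H →ₗ.[ℂ] H} (hS : S.IsFormalAdjoint S) (z : ℂ)
    (x : S.domain) : |z.im| * ‖(x : H)‖ ≤ ‖S x - z • (x : H)‖ := by
  have h1 : (inner ℂ (x : H) (S x - z • (x : H))).im = -(z.im * ‖(x : H)‖ ^ 2) := by
    have e : inner ℂ (x : H) (x : H) = ((‖(x : H)‖ ^ 2 : ℝ) : ℂ) := by
      rw [inner_self_eq_norm_sq_to_K, Complex.ofReal_pow]
      rfl
    rw [inner_sub_right, inner_smul_right, e, Complex.sub_im, hS.im_inner_self_eq_zero,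
      Complex.im_mul_ofReal, zero_sub]
  have h2 : |z.im| * ‖(x : H)‖ ^ 2 ≤ ‖(x : H)‖ * ‖S x - z • (x : H)‖ := by
    calc |z.im| * ‖(x : H)‖ ^ 2 = |(inner ℂ (x : H) (S x - z • (x : H))).im| := by
          rw [h1, abs_neg, abs_mul, abs_of_nonneg (sq_nonneg ‖(x : H)‖)]
      _ ≤ ‖inner ℂ (x : H) (S x - z • (x : H))‖ := Complex.abs_im_le_norm _
      _ ≤ _ := norm_inner_le_norm _ _
  rcases (norm_nonneg (x : H)).eq_or_lt with h0 | h0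
  · rw [← h0, mul_zero]
    exact norm_nonneg _
  · refine le_of_mul_le_mul_left ?_ h0
    linarith

/-- A Weyl sequence for `A - z` shows that `z` lies in the spectrum. -/
theorem mem_unboundedSpectrum_of_forall_exists {A : H →ₗ.[ℂ] H} {z : ℂ}
    (h : ∀ ε : ℝ, 0 < ε → ∃ x : A.domain, (x : H) ≠ 0 ∧ ‖A x - z • (x : H)‖ ≤ ε * ‖(x : H)‖) :
    z ∈ unboundedSpectrum A := by
  rintro ⟨R, hR, -⟩
  -- Any ε with ‖R‖ ε < 1 contradicts boundedness of the inverse; the summand 1 also covers R = 0.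
  obtain ⟨x, hx0, hx⟩ := h (‖R‖ + 1)⁻¹ (by positivity)
  have h1 : ‖(x : H)‖ ≤ ‖R‖ * ((‖R‖ + 1)⁻¹ * ‖(x : H)‖) := by
    calc ‖(x : H)‖ = ‖R (A x - z • (x : H))‖ := by rw [hR]
      _ ≤ ‖R‖ * ‖A x - z • (x : H)‖ := R.le_opNorm _
      _ ≤ _ := by gcongr
  have h2 : 0 < ‖(x : H)‖ := norm_pos_iff.mpr hx0
  rw [← mul_assoc, ← div_eq_mul_inv] at h1
  have h3 : ‖R‖ / (‖R‖ + 1) < 1 := by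
    rw [div_lt_one (by positivity)]
    linarith
  nlinarith

/-- Symmetry is a closed condition on pairs of points of the graph, so it passes to the closure of
the graph one slot at a time. -/
theorem isFormalAdjoint_closure {T : H →ₗ.[ℂ] H} (hT : T.IsClosable)
    (hs : T.IsFormalAdjoint T) : T.closure.IsFormalAdjoint T.closure := by
  have key : ∀ p ∈ T.closure.graph, ∀ q ∈ T.closure.graph,
      inner ℂ p.2 q.1 = inner ℂ p.1 q.2 := by
    rw [← hT.graph_closure_eq_closure_graph]
    have h1 : ∀ p ∈ T.graph, ∀ q ∈ T.graph.topologicalClosure,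
        inner ℂ p.2 q.1 = inner ℂ p.1 q.2 := by
      intro p hp
      refine closure_minimal (s := (T.graph : Set (H × H)))
        (t := {q | inner ℂ p.2 q.1 = inner ℂ p.1 q.2}) ?_
        (isClosed_eq (by fun_prop) (by fun_prop))
      intro q hq
      obtain ⟨x, hx1, hx2⟩ := (mem_graph_iff _).mp hp
      obtain ⟨y, hy1, hy2⟩ := (mem_graph_iff _).mp hq
      simp only [Set.mem_ofPred_eq]
      rw [← hx1, ← hx2, ← hy1, ← hy2]
      exact hs x y
    intro p hp q hq
    revert p
    refine closure_minimal (s := (T.graph : Set (H × H)))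
      (t := {p | inner ℂ p.2 q.1 = inner ℂ p.1 q.2}) ?_
      (isClosed_eq (by fun_prop) (by fun_prop))
    exact fun p hp => h1 p hp q hq
  exact fun x y => key _ (mem_graph _ x) _ (mem_graph _ y)

variable [CompleteSpace H]

/-- A closed symmetric operator `S` maps onto `H` after subtracting a non-real `z`, provided the
range of `S - z` has trivial orthogonal complement. -/
theorem exists_apply_sub_smul_eq {S : H →ₗ.[ℂ] H} (hcl : S.IsClosed)
    (hS : S.IsFormalAdjoint S) {z : ℂ} (hz : z.im ≠ 0)
    (hr : ∀ u : H, (∀ x : S.domain, inner ℂ u (S x - z • (x : H)) = 0) → u = 0) (y : H) :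
    ∃ x : S.domain, S x - z • (x : H) = y := by
  have : CompleteSpace S.graph := hcl.completeSpace_coe
  -- On the graph, which is complete because S is closed, S - z becomes a bounded map; a lower bound
  -- for it makes the range closed.
  let Φ : S.graph →L[ℂ] H :=
    (ContinuousLinearMap.snd ℂ H H - z • ContinuousLinearMap.fst ℂ H H) ∘L S.graph.subtypeL
  have hΦ : ∀ p : S.graph, Φ p = (p : H × H).2 - z • (p : H × H).1 := fun p => rfl
  have hz' : 0 < |z.im| := abs_pos.mpr hz
  -- With c = ‖Φ(a, b)‖, symmetry gives ‖a‖ ≤ c/|Im z|, and then ‖b‖ ≤ c + |z|‖a‖. The constant is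
  -- the sum of the two bounds, which dominates their maximum, the norm on the product.
  have hanti : ∀ p : S.graph, ‖p‖ ≤ (1 + (1 + ‖z‖) / |z.im|) * ‖Φ p‖ := by
    rintro ⟨⟨a, b⟩, hp⟩
    obtain ⟨x, hx1, hx2⟩ := (mem_graph_iff _).mp hp
    have h := hS.abs_im_mul_norm_le z x
    simp only at hx1 hx2
    rw [hx1, hx2] at h
    rw [hΦ]
    change ‖(a, b)‖ ≤ _ * ‖b - z • a‖
    have ha : ‖a‖ ≤ ‖b - z • a‖ / |z.im| := by
      rw [le_div_iff₀ hz']; linarith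
    have hb : ‖b‖ ≤ ‖b - z • a‖ + ‖z‖ * ‖a‖ := by
      rw [← norm_smul]
      simpa using norm_add_le (b - z • a) (z • a)
    have e : (1 + (1 + ‖z‖) / |z.im|) * ‖b - z • a‖
        = ‖b - z • a‖ + ‖b - z • a‖ / |z.im| + ‖z‖ * (‖b - z • a‖ / |z.im|) := by
      field_simp
      ring
    have h3 : ‖z‖ * ‖a‖ ≤ ‖z‖ * (‖b - z • a‖ / |z.im|) := by gcongr
    have h4 : 0 ≤ ‖z‖ * (‖b - z • a‖ / |z.im|) := by positivity
    have h5 : 0 ≤ ‖b - z • a‖ / |z.im| := by positivity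
    rw [e, Prod.norm_def]
    exact max_le (by linarith [norm_nonneg (b - z • a)]) (by linarith)
  have hclosed : _root_.IsClosed (LinearMap.range Φ.toLinearMap : Set H) := by
    have hA : AntilipschitzWith (Real.toNNReal (1 + (1 + ‖z‖) / |z.im|)) Φ := by
      refine AddMonoidHomClass.antilipschitz_of_bound Φ fun p => ?_
      rw [Real.coe_toNNReal _ (by positivity)]
      exact hanti p
    have := hA.isClosed_range Φ.uniformContinuous
    rwa [LinearMap.coe_range]
  have htop : LinearMap.range Φ.toLinearMap = ⊤ := by
    have : CompleteSpace (LinearMap.range Φ.toLinearMap) := hclosed.completeSpace_coe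
    rw [← Submodule.orthogonal_eq_bot_iff, Submodule.eq_bot_iff]
    intro u hu
    refine hr u fun x => ?_
    rw [Submodule.mem_orthogonal'] at hu
    exact hu _ ⟨⟨((x : H), S x), mem_graph S x⟩, rfl⟩
  obtain ⟨⟨p, hp⟩, hpy⟩ : y ∈ LinearMap.range Φ.toLinearMap := htop ▸ Submodule.mem_top
  obtain ⟨x, hx1, hx2⟩ := (mem_graph_iff _).mp hp
  exact ⟨x, by rw [hx1, hx2]; exact hpy⟩

/-- The basic criterion for essential self-adjointness. -/
theorem isEssentiallySelfAdjoint_of_ker_eq_bot {T : H →ₗ.[ℂ] H}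
    (hd : Dense (T.domain : Set H)) (hs : T.IsFormalAdjoint T)
    (hker : ∀ z : ℂ, z.im = 1 ∨ z.im = -1 → ∀ u : H,
      (∀ x : T.domain, inner ℂ u (T x - z • (x : H)) = 0) → u = 0) :
    IsEssentiallySelfAdjoint T := by
  refine ⟨hd, hs, ?_⟩
  have hTcl : T.IsClosable := (adjoint_isClosed hd).isClosable.leIsClosable (hs.le_adjoint hd)
  have hle := T.le_closure
  have hSs := isFormalAdjoint_closure hTcl hs
  have hSd : Dense (T.closure.domain : Set H) := hd.mono hle.1
  have hker' : ∀ z : ℂ, z.im = 1 ∨ z.im = -1 → ∀ u : H,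
      (∀ x : T.closure.domain, inner ℂ u (T.closure x - z • (x : H)) = 0) → u = 0 := by
    intro z hz u hu
    refine hker z hz u fun x => ?_
    rw [hle.2 (x := x) (y := ⟨x, hle.1 x.2⟩) rfl]
    exact hu ⟨x, hle.1 x.2⟩
  rw [isSelfAdjoint_def]
  refine le_antisymm ?_ (hSs.le_adjoint hSd)
  refine le_of_le_graph ?_
  rintro p hp
  obtain ⟨u, hu1, hu2⟩ := (mem_graph_iff _).mp hp
  -- With S the closure and u in the domain of S*, solve (S - i)x = (S* - i)u. Then u - x is
  -- orthogonal to the range of S + i, hence zero, so u already lies in the domain of S.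
  obtain ⟨x, hx⟩ := exists_apply_sub_smul_eq hTcl.closure_isClosed hSs (z := Complex.I)
    (by simp) (hker' _ (by simp)) (p.2 - Complex.I • p.1)
  have hux : p.1 - (x : H) = 0 := by
    refine hker' (-Complex.I) (by simp) _ fun y => ?_
    have h1 := (adjoint_isFormalAdjoint hSd) u y
    have h2 := hSs x y
    rw [hu2, hu1] at h1
    have h3 : p.2 - T.closure x = Complex.I • (p.1 - (x : H)) := by
      rw [smul_sub, sub_eq_sub_iff_add_eq_add, add_comm _ (T.closure x)]
      exact (sub_eq_sub_iff_add_eq_add.mp hx).symm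
    have h4 := congrArg (fun w => inner ℂ w (y : H)) h3
    simp only [inner_sub_left, inner_smul_left, h1, h2, Complex.conj_I] at h4
    simp only [inner_sub_left, inner_sub_right, inner_smul_right]
    linear_combination h4
  have hux' : p.1 = x := sub_eq_zero.mp hux
  refine (mem_graph_iff _).mpr ⟨x, hux'.symm, ?_⟩
  rw [hux'] at hx
  exact sub_left_injective hx

/-- A self-adjoint B is closed, so it extends the closure of T; taking adjoints reverses this
inclusion, and both operators are their own adjoints. -/
theorem IsEssentiallySelfAdjoint.eq_closure {T B : H →ₗ.[ℂ] H}
    (hT : IsEssentiallySelfAdjoint T) (hB : IsSelfAdjoint B) (hle : T ≤ B) : B = T.closure := by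
  have h1 : T.closure ≤ B := by
    have h := hB.isClosed.isClosable.closure_mono hle
    have hBc : B.closure = B := by
      refine eq_of_eq_graph ?_
      rw [← hB.isClosed.isClosable.graph_closure_eq_closure_graph]
      exact hB.isClosed.submodule_topologicalClosure_eq
    rwa [hBc] at h
  refine le_antisymm ?_ h1
  have h2 : B.IsFormalAdjoint B := by
    have := adjoint_isFormalAdjoint hB.dense_domain
    rwa [isSelfAdjoint_def.mp hB] at this
  have h3 : T.closure.IsFormalAdjoint B := fun x y => by
    rw [h1.2 (x := x) (y := ⟨x, h1.1 x.2⟩) rfl]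
    exact h2 ⟨x, h1.1 x.2⟩ y
  have h4 := h3.le_adjoint hT.selfAdjoint_closure.dense_domain
  rwa [isSelfAdjoint_def.mp hT.selfAdjoint_closure] at h4

theorem notMem_unboundedSpectrum_of_im_ne_zero {A : H →ₗ.[ℂ] H} (hA : IsSelfAdjoint A) {z : ℂ}
    (hz : z.im ≠ 0) : z ∉ unboundedSpectrum A := by
  have hs : A.IsFormalAdjoint A := by
    have := adjoint_isFormalAdjoint hA.dense_domain
    rwa [isSelfAdjoint_def.mp hA] at this
  -- Orthogonality to the range of A - z says that u is in the domain of A* = A with Au = z̄u, and a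
  -- symmetric operator has no non-real eigenvalue.
  have hker : ∀ u : H, (∀ x : A.domain, inner ℂ u (A x - z • (x : H)) = 0) → u = 0 := by
    intro u hu
    have hu' : ∀ x : A.domain, inner ℂ ((starRingEnd ℂ z) • u) (x : H) = inner ℂ u (A x) := by
      intro x
      have := hu x
      rw [inner_sub_right, inner_smul_right, sub_eq_zero] at this
      rw [inner_smul_left, Complex.conj_conj, this]
    have hmem : u ∈ A.adjoint.domain := mem_adjoint_domain_of_exists u ⟨_, hu'⟩
    have happ := adjoint_apply_eq hA.dense_domain ⟨u, hmem⟩ hu'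
    have hg : (u, (starRingEnd ℂ z) • u) ∈ A.graph := by
      rw [← isSelfAdjoint_def.mp hA]
      exact (mem_graph_iff _).mpr ⟨⟨u, hmem⟩, rfl, happ⟩
    obtain ⟨x, hx1, hx2⟩ := (mem_graph_iff _).mp hg
    simp only at hx1 hx2
    have h := hs.abs_im_mul_norm_le (starRingEnd ℂ z) x
    rw [hx2, hx1, sub_self, norm_zero, Complex.conj_im, abs_neg] at h
    have : ‖u‖ ≤ 0 := by
      by_contra! h'
      exact absurd h (not_le.mpr (mul_pos (abs_pos.mpr hz) h'))
    exact norm_le_zero_iff.mp this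
  have hsurj := exists_apply_sub_smul_eq hA.isClosed hs hz hker
  have hz' : 0 < |z.im| := abs_pos.mpr hz
  let L : A.domain →ₗ[ℂ] H := A.toFun - z • A.domain.subtype
  have hL : ∀ x : A.domain, L x = A x - z • (x : H) := fun x => rfl
  have hinj : Function.Injective L := by
    rw [injective_iff_map_eq_zero]
    intro x hx
    have h := hs.abs_im_mul_norm_le z x
    rw [← hL, hx, norm_zero] at h
    have : ‖(x : H)‖ ≤ 0 := by
      by_contra! h'
      exact absurd h (not_le.mpr (mul_pos hz' h'))
    exact Subtype.ext (norm_le_zero_iff.mp this)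
  let e : A.domain ≃ₗ[ℂ] H := LinearEquiv.ofBijective L ⟨hinj, hsurj⟩
  let R : H →L[ℂ] H := (A.domain.subtype ∘ₗ e.symm.toLinearMap).mkContinuous |z.im|⁻¹ <| by
    intro y
    have h := hs.abs_im_mul_norm_le z (e.symm y)
    have h' : L (e.symm y) = y := e.apply_symm_apply y
    rw [← hL, h'] at h
    rw [inv_mul_eq_div, le_div_iff₀ hz']
    simpa [mul_comm] using h
  have hR : ∀ y, R y = e.symm y := fun y => rfl
  simp only [unboundedSpectrum, Set.mem_ofPred_eq, not_not]
  refine ⟨R, fun x => ?_, fun y => ⟨e.symm y, (hR y).symm, e.apply_symm_apply y⟩⟩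
  rw [hR, ← hL]
  exact congrArg Subtype.val (e.symm_apply_apply x)

/-- The closure extends T, so approximate eigenvectors in the domain of T itself are enough. -/
theorem unboundedSpectrum_eq_range_ofReal {T : H →ₗ.[ℂ] H} (hT : IsEssentiallySelfAdjoint T)
    (h : ∀ t : ℝ, ∀ ε : ℝ, 0 < ε →
      ∃ x : T.domain, (x : H) ≠ 0 ∧ ‖T x - (t : ℂ) • (x : H)‖ ≤ ε * ‖(x : H)‖) :
    unboundedSpectrum T.closure = Set.range ((↑) : ℝ → ℂ) := by
  refine Set.Subset.antisymm (fun z hz => ?_) ?_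
  · by_contra hz'
    refine notMem_unboundedSpectrum_of_im_ne_zero hT.selfAdjoint_closure (z := z) ?_ hz
    intro him
    exact hz' ⟨z.re, Complex.ext rfl him.symm⟩
  · rintro _ ⟨t, rfl⟩
    refine mem_unboundedSpectrum_of_forall_exists fun ε hε => ?_
    obtain ⟨x, hx0, hx⟩ := h t ε hε
    have hle := T.le_closure
    refine ⟨⟨x, hle.1 x.2⟩, hx0, ?_⟩
    rw [← hle.2 (x := x) (y := ⟨x, hle.1 x.2⟩) rfl]
    exact hx

end Unbounded

end LinearPMap

/-! ### Elliptic regularity in H¹ -/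

open TemperedDistribution in
open scoped Laplacian Real in
-- The Bessel potential of order 2 shifts the Sobolev index by two, and it is a combination of the
-- identity and Δ. If it maps u into H⁻¹, then u is in H¹.
theorem TemperedDistribution.memSobolev_one_of_laplacian {E F : Type*} [NormedAddCommGroup E]
    [NormedAddCommGroup F] [InnerProductSpace ℝ E] [FiniteDimensional ℝ E] [MeasurableSpace E]
    [BorelSpace E] [InnerProductSpace ℂ F] [CompleteSpace F] {u : 𝓢'(E, F)}
    (h0 : MemSobolev (-1) 2 u) (h : MemSobolev (-1) 2 (Δ u)) : MemSobolev 1 2 u := by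
  -- The Bessel symbol is 1 + |ξ|², whereas Δ has symbol -(2π)²|ξ|² in this Fourier normalisation;
  -- hence the factor (2π)⁻².
  have e : besselPotential E F 2 u = u - (((2 * π) ^ 2 : ℝ)⁻¹ : ℂ) • Δ u := by
    have h2 : (fun x : E => (((1 + ‖x‖ ^ 2) ^ ((2 : ℝ) / 2) : ℝ) : ℂ)) =
        fun x => ∑ i : Fin 2, (![fun _ => (1 : ℂ), fun x => Complex.ofReal (‖x‖ ^ 2)] i) x := by
      ext x
      simp
    have hg : ∀ i ∈ (Finset.univ : Finset (Fin 2)), Function.HasTemperateGrowth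
        (![fun _ : E => (1 : ℂ), fun x => Complex.ofReal (‖x‖ ^ 2)] i) := by
      intro i _
      match i with
      | 0 => exact (by fun_prop : Function.HasTemperateGrowth fun _ : E => (1 : ℂ))
      | 1 => exact (by fun_prop : Function.HasTemperateGrowth fun x : E =>
          Complex.ofReal (‖x‖ ^ 2))
    rw [besselPotential, h2, fourierMultiplierCLM_sum F hg, laplacian_eq_fourierMultiplierCLM]
    simp only [Fin.sum_univ_two, Matrix.cons_val_zero, Matrix.cons_val_one]
    rw [fourierMultiplierCLM_const]
    have hpi : (((2 * π) ^ 2 : ℝ) : ℂ) ≠ 0 := by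
      exact_mod_cast (by positivity : ((2 * π) ^ 2 : ℝ) ≠ 0)
    rw [add_apply, one_smul, ContinuousLinearMap.id_apply, neg_smul, smul_neg, sub_neg_eq_add,
      ← Complex.coe_smul ((2 * π) ^ 2), smul_smul, inv_mul_cancel₀ hpi, one_smul]
  have h3 : MemSobolev (-1) 2 (besselPotential E F 2 u) := by
    rw [e]
    exact h0.sub (h.smul _)
  rw [memSobolev_besselPotential_iff] at h3
  norm_num at h3
  exact h3

theorem SchwartzMap.lineDerivOp_lineDerivOp_comm {E F : Type*} [NormedAddCommGroup E]
    [NormedSpace ℝ E] [NormedAddCommGroup F] [NormedSpace ℝ F] (a b : E) (ψ : 𝓢(E, F)) :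
    ∂_{a} (∂_{b} ψ) = ∂_{b} (∂_{a} ψ) := by
  have key : ∀ (a b x : E), ∂_{a} (∂_{b} ψ) x = fderiv ℝ (fderiv ℝ ψ) x a b := by
    intro a b x
    have hd : DifferentiableAt ℝ (fderiv ℝ ψ) x := (fderivCLM ℝ E F ψ).differentiableAt
    rw [lineDerivOp_apply_eq_fderiv]
    change fderiv ℝ (fun y => fderiv ℝ ψ y b) x a = _
    rw [fderiv_clm_apply hd (differentiableAt_const b)]
    simp
  ext x
  rw [key, key]
  exact ((ψ.smooth 2).contDiffAt.isSymmSndFDerivAt (by simp)) a b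

section Spinor

variable {d n : ℕ}

theorem mem_sobolevH1_of_laplacian {f : SpinorL2 d n}
    (h : TemperedDistribution.MemSobolev (-1) 2
      (Laplacian.laplacian (f : 𝓢'(EuclideanSpace ℝ (Fin d), EuclideanSpace ℂ (Fin n))))) :
    f ∈ sobolevH1 d n := by
  refine TemperedDistribution.memSobolev_one_of_laplacian ?_ h
  exact TemperedDistribution.MemSobolev.mono (s := 0) (by norm_num)
    (TemperedDistribution.memSobolev_zero_iff.mpr ⟨f, rfl⟩)

theorem memSobolev_lineDeriv_spinorL2 (f : SpinorL2 d n) (m : EuclideanSpace ℝ (Fin d)) :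
    TemperedDistribution.MemSobolev (-1) 2
      (∂_{m} (f : 𝓢'(EuclideanSpace ℝ (Fin d), EuclideanSpace ℂ (Fin n)))) := by
  have h : TemperedDistribution.MemSobolev 0 2
      (f : 𝓢'(EuclideanSpace ℝ (Fin d), EuclideanSpace ℂ (Fin n))) :=
    TemperedDistribution.memSobolev_zero_iff.mpr ⟨f, rfl⟩
  have := h.lineDerivOp (m := m)
  rwa [zero_sub] at this

theorem memSobolev_sum {ι : Type*} (s : Finset ι)
    (u : ι → 𝓢'(EuclideanSpace ℝ (Fin d), EuclideanSpace ℂ (Fin n))) {r : ℝ}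
    (h : ∀ i ∈ s, TemperedDistribution.MemSobolev r 2 (u i)) :
    TemperedDistribution.MemSobolev r 2 (∑ i ∈ s, u i) := by
  classical
  induction s using Finset.induction_on with
  | empty => simp
  | insert a s ha ih =>
    rw [Finset.sum_insert ha]
    exact (h a (by simp)).add (ih fun i hi => h i (by simp [hi]))

theorem laplacian_eq_sum_single (u : 𝓢'(EuclideanSpace ℝ (Fin d), EuclideanSpace ℂ (Fin n))) :
    Laplacian.laplacian u = ∑ j : Fin d, ∂_{EuclideanSpace.single j (1 : ℝ)}
      (∂_{EuclideanSpace.single j (1 : ℝ)} u) := by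
  rw [TemperedDistribution.laplacian_eq_sum (EuclideanSpace.basisFun (Fin d) ℝ)]
  simp

/-- Δf is then a sum of first derivatives of L² functions, so it lies in H⁻¹. -/
theorem mem_sobolevH1_of_lineDeriv {f : SpinorL2 d n} (g : Fin d → SpinorL2 d n)
    (h : ∀ j, (g j : 𝓢'(EuclideanSpace ℝ (Fin d), EuclideanSpace ℂ (Fin n))) =
      ∂_{EuclideanSpace.single j (1 : ℝ)}
        (f : 𝓢'(EuclideanSpace ℝ (Fin d), EuclideanSpace ℂ (Fin n)))) :
    f ∈ sobolevH1 d n := by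
  refine mem_sobolevH1_of_laplacian ?_
  rw [laplacian_eq_sum_single]
  refine memSobolev_sum _ _ fun j _ => ?_
  rw [← h]
  exact memSobolev_lineDeriv_spinorL2 _ _

theorem partialDeriv_eq_of_lineDeriv {f g : SpinorL2 d n} (hf : f ∈ sobolevH1 d n) {j : Fin d}
    (h : (g : 𝓢'(EuclideanSpace ℝ (Fin d), EuclideanSpace ℂ (Fin n))) =
      ∂_{EuclideanSpace.single j (1 : ℝ)}
        (f : 𝓢'(EuclideanSpace ℝ (Fin d), EuclideanSpace ℂ (Fin n)))) :
    partialDeriv j ⟨f, hf⟩ = g :=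
  SpinorL2.toTemperedDistribution_injective ((partialDeriv_spec j ⟨f, hf⟩).trans h.symm)

theorem coeFn_matrixAct (M : Matrix (Fin n) (Fin n) ℂ) (f : SpinorL2 d n) :
    matrixAct M f =ᵐ[volume] fun x => Matrix.toEuclideanCLM (𝕜 := ℂ) M (f x) :=
  ContinuousLinearMap.coeFn_compLpL _ f

theorem toTemperedDistribution_matrixAct_apply (M : Matrix (Fin n) (Fin n) ℂ) (f : SpinorL2 d n)
    (ψ : 𝓢(EuclideanSpace ℝ (Fin d), ℂ)) :
    (matrixAct M f : 𝓢'(EuclideanSpace ℝ (Fin d), EuclideanSpace ℂ (Fin n))) ψ =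
      Matrix.toEuclideanCLM (𝕜 := ℂ) M
        ((f : 𝓢'(EuclideanSpace ℝ (Fin d), EuclideanSpace ℂ (Fin n))) ψ) := by
  rw [Lp.toTemperedDistribution_apply, Lp.toTemperedDistribution_apply,
    ← ContinuousLinearMap.integral_comp_comm]
  · refine integral_congr_ae ?_
    filter_upwards [coeFn_matrixAct M f] with x hx
    rw [hx, map_smul]
  · exact memLp_one_iff_integrable.mp ((Lp.memLp f).smul (ψ.memLp 2 volume))

/-- Elliptic regularity for the free Dirac operator: if `f ∈ L²` and `∑ⱼ γⱼ ∂ⱼ f ∈ L²`, then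
`f ∈ H¹`. -/
theorem mem_sobolevH1_of_dirac {γ : Fin d → Matrix (Fin n) (Fin n) ℂ}
    (hγ : ∀ i j, γ i * γ j + γ j * γ i = if i = j then (2 : ℂ) • 1 else 0) {f w : SpinorL2 d n}
    (h : ∀ ψ : 𝓢(EuclideanSpace ℝ (Fin d), ℂ),
      ∑ j, Matrix.toEuclideanCLM (𝕜 := ℂ) (γ j)
        ((f : 𝓢'(EuclideanSpace ℝ (Fin d), EuclideanSpace ℂ (Fin n)))
          (∂_{EuclideanSpace.single j (1 : ℝ)} ψ)) =
        -(w : 𝓢'(EuclideanSpace ℝ (Fin d), EuclideanSpace ℂ (Fin n))) ψ) :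
    f ∈ sobolevH1 d n := by
  refine mem_sobolevH1_of_laplacian ?_
  -- The hypothesis says w = Df in the sense of distributions, so this is Δf = D(Df), tested against
  -- ψ.
  have e : Laplacian.laplacian (f : 𝓢'(EuclideanSpace ℝ (Fin d), EuclideanSpace ℂ (Fin n))) =
      ∑ i, ∂_{EuclideanSpace.single i (1 : ℝ)}
        (matrixAct (γ i) w : 𝓢'(EuclideanSpace ℝ (Fin d), EuclideanSpace ℂ (Fin n))) := by
    rw [laplacian_eq_sum_single]
    ext1 ψ
    have hcomm : ∀ i j : Fin d,
        ∂_{EuclideanSpace.single i (1 : ℝ)} (∂_{EuclideanSpace.single j (1 : ℝ)} ψ) =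
          ∂_{EuclideanSpace.single j (1 : ℝ)} (∂_{EuclideanSpace.single i (1 : ℝ)} ψ) := by
      intro i j
      exact SchwartzMap.lineDerivOp_lineDerivOp_comm _ _ ψ
    set S : Fin d → Fin d → EuclideanSpace ℂ (Fin n) := fun i j =>
      (f : 𝓢'(EuclideanSpace ℝ (Fin d), EuclideanSpace ℂ (Fin n)))
        (∂_{EuclideanSpace.single i (1 : ℝ)} (∂_{EuclideanSpace.single j (1 : ℝ)} ψ)) with hS
    have hSc : ∀ i j, S i j = S j i := fun i j => by simp only [hS, hcomm i j]
    simp only [sum_apply, TemperedDistribution.lineDerivOp_apply_apply, map_neg,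
      neg_neg, toTemperedDistribution_matrixAct_apply]
    set A : Fin d → EuclideanSpace ℂ (Fin n) →L[ℂ] EuclideanSpace ℂ (Fin n) :=
      fun i => Matrix.toEuclideanCLM (𝕜 := ℂ) (γ i) with hA
    have hAA : ∀ i j v, A i (A j v) + A j (A i v) = if i = j then (2 : ℂ) • v else 0 := by
      intro i j v
      have h1 := congrArg (fun M => Matrix.toEuclideanCLM (𝕜 := ℂ) M v) (hγ i j)
      simp only [map_add, map_mul] at h1
      refine h1.trans ?_
      split_ifs
      · simp
      · simp
    have h1 : ∀ i, -A i ((w : 𝓢'(EuclideanSpace ℝ (Fin d), EuclideanSpace ℂ (Fin n)))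
        (∂_{EuclideanSpace.single i (1 : ℝ)} ψ)) = ∑ j, A i (A j (S j i)) := by
      intro i
      rw [← map_neg, ← h, map_sum]
    change ∑ i, S i i = ∑ i, -A i ((w : 𝓢'(EuclideanSpace ℝ (Fin d), EuclideanSpace ℂ (Fin n)))
        (∂_{EuclideanSpace.single i (1 : ℝ)} ψ))
    simp_rw [h1]
    -- Since S is symmetric, the order of the two matrices may be swapped; averaging both orders
    -- leaves the anticommutator, of which only the diagonal survives.
    have h2 : ∑ i, ∑ j, A i (A j (S j i)) = ∑ i, ∑ j, A j (A i (S j i)) := by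
      rw [Finset.sum_comm]
      simp_rw [fun i j => hSc j i]
    have h3 : (2 : ℂ) • ∑ i, ∑ j, A i (A j (S j i)) = (2 : ℂ) • ∑ i, S i i := by
      rw [two_smul]
      nth_rw 2 [h2]
      simp only [← Finset.sum_add_distrib, hAA]
      simp [Finset.smul_sum]
    exact (smul_right_injective _ two_ne_zero h3).symm
  rw [e]
  exact memSobolev_sum _ _ fun j _ => memSobolev_lineDeriv_spinorL2 _ _

end Spinor

/-! ### Symmetry of the Dirac operator and its action on test functions -/

/-- Moving -i across the inner product conjugates it, and this sign cancels that of integration by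
parts. -/
theorem inner_neg_I_smul_sum_add {ι H : Type*} [Fintype ι] [NormedAddCommGroup H]
    [InnerProductSpace ℂ H] {a b : ι → H} {f g p q : H}
    (h : ∀ j, inner ℂ (a j) g = -inner ℂ f (b j)) (hpq : inner ℂ p g = inner ℂ f q) :
    inner ℂ ((-Complex.I) • (∑ j, a j) + p) g = inner ℂ f ((-Complex.I) • (∑ j, b j) + q) := by
  rw [inner_add_left, inner_add_right, hpq, inner_smul_left, inner_smul_right, sum_inner,
    inner_sum]
  simp [h]

section Spinor

variable {d n : ℕ}

open FourierTransform in
open scoped Real ContDiff in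
-- The multiplier is unbounded, so the right-hand side is only known to be locally integrable; the
-- two sides are compared by testing against smooth compactly supported functions, where the
-- distributional identity becomes an equality of integrals.
theorem coeFn_fourier_partialDeriv (j : Fin d) (f : sobolevH1 d n) :
    (𝓕 (partialDeriv j f) : SpinorL2 d n) =ᵐ[volume]
      fun ξ => (2 * π * Complex.I * ξ j) • (𝓕 (f : SpinorL2 d n) : SpinorL2 d n) ξ := by
  set F := (𝓕 (f : SpinorL2 d n) : SpinorL2 d n) with hF
  have hc : Continuous fun ξ : EuclideanSpace ℝ (Fin d) => (2 * π * Complex.I * ξ j : ℂ) := by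
    fun_prop
  have hloc : LocallyIntegrable F volume := (Lp.memLp F).locallyIntegrable (by norm_num)
  have hloc' : LocallyIntegrable (fun ξ => (2 * π * Complex.I * ξ j : ℂ) • F ξ) volume := by
    rw [← locallyIntegrableOn_univ] at hloc ⊢
    exact hloc.continuousOn_smul (isClosed_univ.isLocallyClosed) hc.continuousOn
  refine ae_eq_of_integral_contDiff_smul_eq ((Lp.memLp _).locallyIntegrable (by norm_num)) hloc' ?_
  intro g g_smooth g_cpt
  have hg₁ : HasCompactSupport (Complex.ofRealCLM ∘ g) := g_cpt.comp_left rfl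
  have hg₂ : ContDiff ℝ ∞ (Complex.ofRealCLM ∘ g) := by fun_prop
  have h := congrArg 𝓕 (partialDeriv_spec j f)
  rw [Lp.fourier_toTemperedDistribution_eq, TemperedDistribution.fourier_lineDerivOp_eq,
    Lp.fourier_toTemperedDistribution_eq] at h
  have h2 := DFunLike.congr_fun h (hg₁.toSchwartzMap hg₂)
  have ht : Function.HasTemperateGrowth fun x : EuclideanSpace ℝ (Fin d) =>
      ((inner ℝ x (EuclideanSpace.single j (1 : ℝ)) : ℝ) : ℂ) := by fun_prop
  rw [Lp.toTemperedDistribution_apply] at h2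
  simp only [smul_apply, TemperedDistribution.smulLeftCLM_apply_apply,
    Lp.toTemperedDistribution_apply, SchwartzMap.smulLeftCLM_apply_apply ht] at h2
  rw [← integral_smul] at h2
  convert! h2 using 1
  refine integral_congr_ae (.of_forall fun ξ => ?_)
  simp only [HasCompactSupport.toSchwartzMap_toFun, Function.comp_apply, Complex.ofRealCLM_apply,
    smul_smul, smul_eq_mul, ← hF, ← Complex.coe_smul (g ξ)]
  congr 1
  simp only [EuclideanSpace.inner_single_right, one_mul, conj_trivial]
  ring

/-- By Plancherel, since the multiplier 2πiξⱼ is purely imaginary. -/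
theorem inner_partialDeriv_left (j : Fin d) (f g : sobolevH1 d n) :
    inner ℂ (partialDeriv j f) (g : SpinorL2 d n) =
      -inner ℂ (f : SpinorL2 d n) (partialDeriv j g) := by
  rw [← Lp.inner_fourier_eq, ← Lp.inner_fourier_eq (f : SpinorL2 d n), L2.inner_def, L2.inner_def,
    ← integral_neg]
  refine integral_congr_ae ?_
  filter_upwards [coeFn_fourier_partialDeriv j f, coeFn_fourier_partialDeriv j g] with ξ h1 h2
  rw [h1, h2, inner_smul_left, inner_smul_right]
  simp only [map_mul, Complex.conj_ofReal, Complex.conj_I, map_ofNat]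
  ring

theorem inner_toEuclideanCLM_left {M : Matrix (Fin n) (Fin n) ℂ} (hM : M.IsHermitian)
    (v w : EuclideanSpace ℂ (Fin n)) :
    inner ℂ (Matrix.toEuclideanCLM (𝕜 := ℂ) M v) w =
      inner ℂ v (Matrix.toEuclideanCLM (𝕜 := ℂ) M w) := by
  rw [← ContinuousLinearMap.adjoint_inner_right, ← ContinuousLinearMap.star_eq_adjoint,
    ← map_star, Matrix.star_eq_conjTranspose, hM.eq]

theorem inner_matrixAct_left {M : Matrix (Fin n) (Fin n) ℂ} (hM : M.IsHermitian)
    (f g : SpinorL2 d n) : inner ℂ (matrixAct M f) g = inner ℂ f (matrixAct M g) := by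
  rw [L2.inner_def, L2.inner_def]
  refine integral_congr_ae ?_
  filter_upwards [coeFn_matrixAct M f, coeFn_matrixAct M g] with x h1 h2
  rw [h1, h2, inner_toEuclideanCLM_left hM]

theorem partialDeriv_matrixAct (M : Matrix (Fin n) (Fin n) ℂ) (j : Fin d) (f : sobolevH1 d n) :
    ∃ h : matrixAct M (f : SpinorL2 d n) ∈ sobolevH1 d n,
      partialDeriv j ⟨matrixAct M (f : SpinorL2 d n), h⟩ = matrixAct M (partialDeriv j f) := by
  have key : ∀ i, (matrixAct M (partialDeriv i f) :
      𝓢'(EuclideanSpace ℝ (Fin d), EuclideanSpace ℂ (Fin n))) =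
      ∂_{EuclideanSpace.single i (1 : ℝ)} (matrixAct M (f : SpinorL2 d n) :
        𝓢'(EuclideanSpace ℝ (Fin d), EuclideanSpace ℂ (Fin n))) := by
    intro i
    ext1 ψ
    rw [toTemperedDistribution_matrixAct_apply, partialDeriv_spec,
      TemperedDistribution.lineDerivOp_apply_apply, TemperedDistribution.lineDerivOp_apply_apply,
      toTemperedDistribution_matrixAct_apply]
  exact ⟨mem_sobolevH1_of_lineDeriv _ key, partialDeriv_eq_of_lineDeriv _ (key j)⟩

theorem coeFn_potentialMul (q : EuclideanSpace ℝ (Fin d) → ℝ) (f : potentialDomain n q) :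
    potentialMul n q f =ᵐ[volume] fun x => (q x : ℂ) • (f : SpinorL2 d n) x :=
  MemLp.coeFn_toLp f.2

theorem inner_potentialMul_left (q : EuclideanSpace ℝ (Fin d) → ℝ) (f g : potentialDomain n q) :
    inner ℂ (potentialMul n q f) (g : SpinorL2 d n) =
      inner ℂ (f : SpinorL2 d n) (potentialMul n q g) := by
  rw [L2.inner_def, L2.inner_def]
  refine integral_congr_ae ?_
  filter_upwards [coeFn_potentialMul q f, coeFn_potentialMul q g] with x h1 h2
  rw [h1, h2, inner_smul_left, inner_smul_right, Complex.conj_ofReal]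

theorem inner_matrixAct_partialDeriv_left {M : Matrix (Fin n) (Fin n) ℂ} (hM : M.IsHermitian)
    (j : Fin d) (f g : sobolevH1 d n) :
    inner ℂ (matrixAct M (partialDeriv j f)) (g : SpinorL2 d n) =
      -inner ℂ (f : SpinorL2 d n) (matrixAct M (partialDeriv j g)) := by
  obtain ⟨h, e⟩ := partialDeriv_matrixAct M j g
  rw [inner_matrixAct_left hM, ← e]
  exact inner_partialDeriv_left j f ⟨_, h⟩

/-- The Dirac operator is symmetric. -/
theorem diracOperator_isFormalAdjoint {γ : Fin d → Matrix (Fin n) (Fin n) ℂ}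
    (hγ : ∀ j, (γ j).IsHermitian) (q : EuclideanSpace ℝ (Fin d) → ℝ) :
    (diracOperator γ q).IsFormalAdjoint (diracOperator γ q) := by
  rintro ⟨f, hf⟩ ⟨g, hg⟩
  have hf' : f ∈ sobolevH1 d n ∧ f ∈ potentialDomain n q := hf
  have hg' : g ∈ sobolevH1 d n ∧ g ∈ potentialDomain n q := hg
  have e1 := diracOperator_apply γ q ⟨f, hf⟩
  have e2 := diracOperator_apply γ q ⟨g, hg⟩
  have hj := fun j => inner_matrixAct_partialDeriv_left (hγ j) j ⟨f, hf'.1⟩ ⟨g, hg'.1⟩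
  have hq := inner_potentialMul_left q ⟨f, hf'.2⟩ ⟨g, hg'.2⟩
  exact (congrArg (fun w => inner ℂ w g) e1).trans ((inner_neg_I_smul_sum_add hj hq).trans
    (congrArg (fun w => inner ℂ f w) e2).symm)

/-- A continuous compactly supported function as an element of `L²`. -/
noncomputable def compactToL2 (f : EuclideanSpace ℝ (Fin d) → EuclideanSpace ℂ (Fin n))
    (hf : Continuous f) (hc : HasCompactSupport f) : SpinorL2 d n :=
  (hf.memLp_of_hasCompactSupport hc).toLp f

theorem coeFn_compactToL2 {f : EuclideanSpace ℝ (Fin d) → EuclideanSpace ℂ (Fin n)}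
    (hf : Continuous f) (hc : HasCompactSupport f) : compactToL2 f hf hc =ᵐ[volume] f :=
  MemLp.coeFn_toLp _

theorem continuous_fderiv_single {f : EuclideanSpace ℝ (Fin d) → EuclideanSpace ℂ (Fin n)}
    (hf : ContDiff ℝ 1 f) (j : Fin d) :
    Continuous fun x => fderiv ℝ f x (EuclideanSpace.single j 1) :=
  (hf.continuous_fderiv one_ne_zero).clm_apply continuous_const

/-- Integration by parts against a Schwartz function; compact support of f removes boundary terms.
-/
theorem lineDeriv_compactToL2 {f : EuclideanSpace ℝ (Fin d) → EuclideanSpace ℂ (Fin n)}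
    (hf : ContDiff ℝ 1 f) (hc : HasCompactSupport f) (j : Fin d) :
    (compactToL2 _ (continuous_fderiv_single hf j) (hc.fderiv_apply ℝ _) :
      𝓢'(EuclideanSpace ℝ (Fin d), EuclideanSpace ℂ (Fin n))) =
    ∂_{EuclideanSpace.single j (1 : ℝ)} (compactToL2 f hf.continuous hc :
      𝓢'(EuclideanSpace ℝ (Fin d), EuclideanSpace ℂ (Fin n))) := by
  ext1 ψ
  rw [TemperedDistribution.lineDerivOp_apply_apply, map_neg, Lp.toTemperedDistribution_apply,
    Lp.toTemperedDistribution_apply]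
  have h1 : ∫ x, ψ x • (compactToL2 _ (continuous_fderiv_single hf j) (hc.fderiv_apply ℝ _)) x =
      ∫ x, ψ x • fderiv ℝ f x (EuclideanSpace.single j 1) := by
    refine integral_congr_ae ?_
    filter_upwards [coeFn_compactToL2 (continuous_fderiv_single hf j) (hc.fderiv_apply ℝ _)]
      with x hx
    rw [hx]
  have h2 : ∫ x, (∂_{EuclideanSpace.single j (1 : ℝ)} ψ) x • (compactToL2 f hf.continuous hc) x =
      ∫ x, fderiv ℝ ψ x (EuclideanSpace.single j 1) • f x := by
    refine integral_congr_ae ?_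
    filter_upwards [coeFn_compactToL2 hf.continuous hc] with x hx
    rw [hx, SchwartzMap.lineDerivOp_apply_eq_fderiv]
  have hψ : Continuous fun x => fderiv ℝ ψ x (EuclideanSpace.single j 1) :=
    (∂_{EuclideanSpace.single j (1 : ℝ)} ψ).continuous
  rw [h1, h2]
  refine integral_smul_fderiv_eq_neg_fderiv_smul_of_integrable ?_ ?_ ?_ ?_ ?_
  · exact (hψ.smul hf.continuous).integrable_of_hasCompactSupport hc.smul_left
  · exact (ψ.continuous.smul (continuous_fderiv_single hf j)).integrable_of_hasCompactSupport
      (hc.fderiv_apply ℝ _).smul_left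
  · exact (ψ.continuous.smul hf.continuous).integrable_of_hasCompactSupport hc.smul_left
  · exact fun x _ => ψ.differentiableAt
  · exact fun x _ => hf.differentiable one_ne_zero x

theorem compactToL2_mem_domain {f : EuclideanSpace ℝ (Fin d) → EuclideanSpace ℂ (Fin n)}
    (hf : ContDiff ℝ 1 f) (hc : HasCompactSupport f) (γ : Fin d → Matrix (Fin n) (Fin n) ℂ)
    {q : EuclideanSpace ℝ (Fin d) → ℝ} (hq : Continuous q) :
    compactToL2 f hf.continuous hc ∈ (diracOperator γ q).domain := by
  refine ⟨mem_sobolevH1_of_lineDeriv _ (lineDeriv_compactToL2 hf hc), ?_⟩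
  have h : MemLp (fun x => (q x : ℂ) • f x) 2 volume :=
    ((Complex.continuous_ofReal.comp hq).smul hf.continuous).memLp_of_hasCompactSupport
      hc.smul_left
  refine h.ae_eq ?_
  filter_upwards [coeFn_compactToL2 hf.continuous hc] with x hx
  rw [hx]

/-- On compactly supported `C¹` functions the Dirac operator is the classical differential
operator. -/
theorem coeFn_diracOperator_compactToL2
    {f : EuclideanSpace ℝ (Fin d) → EuclideanSpace ℂ (Fin n)}
    (hf : ContDiff ℝ 1 f) (hc : HasCompactSupport f) (γ : Fin d → Matrix (Fin n) (Fin n) ℂ)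
    {q : EuclideanSpace ℝ (Fin d) → ℝ} (hq : Continuous q) :
    diracOperator γ q ⟨_, compactToL2_mem_domain hf hc γ hq⟩ =ᵐ[volume] fun x =>
      (-Complex.I) • (∑ j, Matrix.toEuclideanCLM (𝕜 := ℂ) (γ j)
        (fderiv ℝ f x (EuclideanSpace.single j 1))) + (q x : ℂ) • f x := by
  have hm := compactToL2_mem_domain hf hc γ hq
  rw [diracOperator_apply]
  have h1 : ∀ j, partialDeriv j ⟨_, hm.1⟩ =
      compactToL2 _ (continuous_fderiv_single hf j) (hc.fderiv_apply ℝ _) :=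
    fun j => partialDeriv_eq_of_lineDeriv hm.1 (lineDeriv_compactToL2 hf hc j)
  have h2 := coeFn_potentialMul q ⟨_, hm.2⟩
  have h3 : ∀ᵐ x, ∀ j, (matrixAct (γ j) (partialDeriv j ⟨_, hm.1⟩) : SpinorL2 d n) x =
      Matrix.toEuclideanCLM (𝕜 := ℂ) (γ j) (fderiv ℝ f x (EuclideanSpace.single j 1)) := by
    rw [ae_all_iff]
    intro j
    filter_upwards [coeFn_matrixAct (γ j) (partialDeriv j ⟨_, hm.1⟩),
      coeFn_compactToL2 (continuous_fderiv_single hf j) (hc.fderiv_apply ℝ _)] with x h4 h5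
    rw [h4, h1, h5]
  filter_upwards [h2, h3, coeFn_compactToL2 hf.continuous hc, Lp.coeFn_add
    ((-Complex.I) • ∑ j, matrixAct (γ j) (partialDeriv j ⟨_, hm.1⟩)) (potentialMul n q ⟨_, hm.2⟩),
    Lp.coeFn_smul (-Complex.I) (∑ j, matrixAct (γ j) (partialDeriv j ⟨_, hm.1⟩)),
    Lp.coeFn_fun_finsetSum Finset.univ fun j => matrixAct (γ j) (partialDeriv j ⟨_, hm.1⟩)]
    with x h2 h3 h4 h5 h6 h7
  rw [h5, Pi.add_apply, h6, Pi.smul_apply, h7, h2, h4]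
  simp only [h3]

end Spinor

/-! ### Localisation by cutoffs and essential self-adjointness -/

/-- The pointwise identity behind localisation, to be read with U = u(x), a = φ, b = ∇φ, p = ψ, r =
∇ψ and Q = q. It moves H - z from the test function φψ̄e onto u, using only the product rule and
Hermitian matrices. -/
theorem inner_dirac_apply {ι F : Type*} [Fintype ι] [NormedAddCommGroup F]
    [InnerProductSpace ℂ F] {A : ι → F →L[ℂ] F} (hA : ∀ j v w, inner ℂ (A j v) w = inner ℂ v (A j w))
    (U e : F) (a Q : ℝ) (p z : ℂ) (b : ι → ℝ) (r : ι → ℂ) :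
    inner ℂ U ((-Complex.I) • (∑ j, A j (((b j : ℂ) * starRingEnd ℂ p +
        (a : ℂ) * starRingEnd ℂ (r j)) • e)) + (Q : ℂ) • ((a : ℂ) * starRingEnd ℂ p) • e -
        z • ((a : ℂ) * starRingEnd ℂ p) • e) =
      -Complex.I * inner ℂ (∑ j, r j • A j ((a : ℂ) • U) + p • (∑ j, A j ((b j : ℂ) • U) -
        Complex.I • (((Q * a : ℝ) : ℂ) • U - starRingEnd ℂ z • (a : ℂ) • U))) e := by
  have h : ∑ j, ((b j : ℂ) * starRingEnd ℂ p + (a : ℂ) * starRingEnd ℂ (r j)) * inner ℂ U (A j e) =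
      starRingEnd ℂ p * ∑ j, (b j : ℂ) * inner ℂ U (A j e) +
        ∑ j, starRingEnd ℂ (r j) * ((a : ℂ) * inner ℂ U (A j e)) := by
    rw [Finset.mul_sum, ← Finset.sum_add_distrib]
    exact Finset.sum_congr rfl fun j _ => by ring
  simp only [map_smul, inner_add_right, inner_add_left, inner_sub_left, inner_sub_right,
    inner_smul_left, inner_smul_right, inner_sum, sum_inner, hA, Complex.conj_conj, map_mul,
    Complex.conj_ofReal, Complex.conj_I, Complex.ofReal_mul, h]
  linear_combination ((starRingEnd ℂ p) * ((Q : ℂ) * a - z * a) * inner ℂ U e) * Complex.I_sq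

section Spinor

variable {d n : ℕ}

open scoped ContDiff in
-- Test functions of the form g·e, with g scalar and e a constant vector, already detect u.
theorem eq_zero_of_forall_inner_compactToL2 {u : SpinorL2 d n}
    (h : ∀ (f : EuclideanSpace ℝ (Fin d) → EuclideanSpace ℂ (Fin n)) (hf : ContDiff ℝ 1 f)
      (hc : HasCompactSupport f), inner ℂ (compactToL2 f hf.continuous hc) u = 0) : u = 0 := by
  rw [Lp.eq_zero_iff_ae_eq_zero]
  have hloc : LocallyIntegrable u volume := (Lp.memLp u).locallyIntegrable (by norm_num)
  refine ae_eq_zero_of_integral_contDiff_smul_eq_zero hloc fun g g_smooth g_cpt => ?_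
  refine ext_inner_left ℂ fun e => ?_
  have hint : Integrable (fun x => g x • u x) volume :=
    hloc.integrable_smul_left_of_hasCompactSupport g_smooth.continuous g_cpt
  rw [inner_zero_right, ← integral_inner hint]
  have hf : ContDiff ℝ 1 fun x => g x • e :=
    (g_smooth.of_le (by norm_cast)).smul contDiff_const
  rw [← h (fun x => g x • e) hf g_cpt.smul_right, L2.inner_def]
  refine integral_congr_ae ?_
  filter_upwards [coeFn_compactToL2 hf.continuous g_cpt.smul_right] with x hx
  rw [hx, ← Complex.coe_smul, ← Complex.coe_smul, inner_smul_left, inner_smul_right,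
    Complex.conj_ofReal]

theorem dense_diracOperator_domain (γ : Fin d → Matrix (Fin n) (Fin n) ℂ)
    {q : EuclideanSpace ℝ (Fin d) → ℝ} (hq : Continuous q) :
    Dense ((diracOperator γ q).domain : Set (SpinorL2 d n)) := by
  rw [Submodule.dense_iff_topologicalClosure_eq_top, Submodule.topologicalClosure_eq_top_iff,
    Submodule.eq_bot_iff]
  intro u hu
  exact eq_zero_of_forall_inner_compactToL2 fun f hf hc =>
    hu _ (compactToL2_mem_domain hf hc γ hq)

/-- Multiplication of an `L²` function by a continuous compactly supported function. -/
noncomputable def compactMul (a : EuclideanSpace ℝ (Fin d) → ℝ) (ha : Continuous a)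
    (hc : HasCompactSupport a) (u : SpinorL2 d n) : SpinorL2 d n :=
  MemLp.toLp (fun x => (a x : ℂ) • u x) <| by
    have h : MemLp (fun x => (a x : ℂ)) ⊤ volume :=
      (Complex.continuous_ofReal.comp ha).memLp_top_of_hasCompactSupport
        (hc.comp_left Complex.ofReal_zero) volume
    exact (Lp.memLp u).smul h

theorem coeFn_compactMul {a : EuclideanSpace ℝ (Fin d) → ℝ} (ha : Continuous a)
    (hc : HasCompactSupport a) (u : SpinorL2 d n) :
    compactMul a ha hc u =ᵐ[volume] fun x => (a x : ℂ) • u x :=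
  MemLp.coeFn_toLp _

theorem norm_compactMul_le {a : EuclideanSpace ℝ (Fin d) → ℝ} (ha : Continuous a)
    (hc : HasCompactSupport a) (u : SpinorL2 d n) {C : ℝ} (hC : ∀ x, |a x| ≤ C) :
    ‖compactMul a ha hc u‖ ≤ C * ‖u‖ := by
  refine Lp.norm_le_mul_norm_of_ae_le_mul ?_
  filter_upwards [coeFn_compactMul ha hc u] with x hx
  rw [hx, norm_smul, Complex.norm_real, Real.norm_eq_abs]
  gcongr
  exact hC x

theorem continuous_fderiv_real_single {φ : EuclideanSpace ℝ (Fin d) → ℝ}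
    (hφ : ContDiff ℝ 1 φ) (j : Fin d) :
    Continuous fun x => fderiv ℝ φ x (EuclideanSpace.single j 1) :=
  (hφ.continuous_fderiv one_ne_zero).clm_apply continuous_const

theorem fderiv_ofReal_mul_conj_smul_apply {φ : EuclideanSpace ℝ (Fin d) → ℝ}
    (hφ : ContDiff ℝ 1 φ) (ψ : 𝓢(EuclideanSpace ℝ (Fin d), ℂ)) (e : EuclideanSpace ℂ (Fin n))
    (x v : EuclideanSpace ℝ (Fin d)) :
    fderiv ℝ (fun x => ((φ x : ℂ) * starRingEnd ℂ (ψ x)) • e) x v =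
      ((fderiv ℝ φ x v : ℂ) * starRingEnd ℂ (ψ x) +
        (φ x : ℂ) * starRingEnd ℂ (fderiv ℝ ψ x v)) • e := by
  have h1 : HasFDerivAt (fun x => (φ x : ℂ)) (Complex.ofRealCLM.comp (fderiv ℝ φ x)) x :=
    Complex.ofRealCLM.hasFDerivAt.comp x (hφ.differentiable one_ne_zero x).hasFDerivAt
  have h2 : HasFDerivAt (fun x => starRingEnd ℂ (ψ x))
      ((Complex.conjCLE : ℂ →L[ℝ] ℂ).comp (fderiv ℝ ψ x)) x :=
    (Complex.conjCLE : ℂ →L[ℝ] ℂ).hasFDerivAt.comp x (ψ.hasFDerivAt x)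
  have h3 : fderiv ℝ (fun x => ((φ x : ℂ) * starRingEnd ℂ (ψ x)) • e) x = _ :=
    ((h1.mul h2).smul_const e).fderiv
  rw [h3]
  simp only [ContinuousLinearMap.smulRight_apply, add_apply,
    smul_apply, ContinuousLinearMap.comp_apply, smul_eq_mul,
    Complex.ofRealCLM_apply]
  congr 1
  rw [add_comm]
  congr 1
  exact mul_comm _ _

/-- If `u` is orthogonal to the range of `H - z`, then for a smooth cutoff `φ` the function `φ u`
lies in the domain of `H`, and `(H - z̄) (φ u) = -i ∑ⱼ (∂ⱼ φ) γⱼ u`. -/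
theorem diracOperator_compactMul {γ : Fin d → Matrix (Fin n) (Fin n) ℂ}
    (hγ : ∀ i j, γ i * γ j + γ j * γ i = if i = j then (2 : ℂ) • 1 else 0)
    (hγh : ∀ j, (γ j).IsHermitian) {q : EuclideanSpace ℝ (Fin d) → ℝ} (hq : Continuous q)
    {z : ℂ} {u : SpinorL2 d n}
    (hu : ∀ f : (diracOperator γ q).domain,
      inner ℂ u (diracOperator γ q f - z • (f : SpinorL2 d n)) = 0)
    {φ : EuclideanSpace ℝ (Fin d) → ℝ} (hφ : ContDiff ℝ 1 φ) (hc : HasCompactSupport φ) :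
    ∃ h : compactMul φ hφ.continuous hc u ∈ (diracOperator γ q).domain,
      diracOperator γ q ⟨_, h⟩ - (starRingEnd ℂ z) • compactMul φ hφ.continuous hc u =
        (-Complex.I) • ∑ j, matrixAct (γ j) (compactMul _ (continuous_fderiv_real_single hφ j)
          (hc.fderiv_apply ℝ _) u) := by
  set v := compactMul φ hφ.continuous hc u with hv
  set G := ∑ j, matrixAct (γ j) (compactMul _ (continuous_fderiv_real_single hφ j)
    (hc.fderiv_apply ℝ _) u) with hG
  set Q := compactMul (fun x => q x * φ x) (hq.mul hφ.continuous) hc.mul_left u with hQ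
  -- This is the claimed equation -iDv + Q - z̄v = -iG solved for Dv.
  set w := G - Complex.I • (Q - (starRingEnd ℂ z) • v) with hw
  have hvx : v =ᵐ[volume] fun x => (φ x : ℂ) • u x := coeFn_compactMul hφ.continuous hc u
  have hQx : Q =ᵐ[volume] fun x => ((q x * φ x : ℝ) : ℂ) • u x :=
    coeFn_compactMul (hq.mul hφ.continuous) hc.mul_left u
  have hGx : G =ᵐ[volume] fun x => ∑ j, Matrix.toEuclideanCLM (𝕜 := ℂ) (γ j)
      ((fderiv ℝ φ x (EuclideanSpace.single j 1) : ℂ) • u x) := by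
    have h1 : ∀ᵐ x, ∀ j, (matrixAct (γ j) (compactMul _ (continuous_fderiv_real_single hφ j)
        (hc.fderiv_apply ℝ _) u) : SpinorL2 d n) x = Matrix.toEuclideanCLM (𝕜 := ℂ) (γ j)
        ((fderiv ℝ φ x (EuclideanSpace.single j 1) : ℂ) • u x) := by
      rw [ae_all_iff]
      intro j
      filter_upwards [coeFn_matrixAct (γ j) (compactMul _ (continuous_fderiv_real_single hφ j)
        (hc.fderiv_apply ℝ _) u), coeFn_compactMul (continuous_fderiv_real_single hφ j)
        (hc.fderiv_apply ℝ _) u] with x h2 h3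
      rw [h2, h3]
    filter_upwards [h1, Lp.coeFn_fun_finsetSum Finset.univ fun j => matrixAct (γ j)
      (compactMul _ (continuous_fderiv_real_single hφ j) (hc.fderiv_apply ℝ _) u)] with x h2 h3
    rw [hG, h3]
    simp only [h2]
  have hwx : w =ᵐ[volume] fun x => ∑ j, Matrix.toEuclideanCLM (𝕜 := ℂ) (γ j)
      ((fderiv ℝ φ x (EuclideanSpace.single j 1) : ℂ) • u x) - Complex.I •
      (((q x * φ x : ℝ) : ℂ) • u x - (starRingEnd ℂ z) • (φ x : ℂ) • u x) := by
    filter_upwards [hGx, hQx, hvx, Lp.coeFn_sub G (Complex.I • (Q - (starRingEnd ℂ z) • v)),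
      Lp.coeFn_smul Complex.I (Q - (starRingEnd ℂ z) • v), Lp.coeFn_sub Q ((starRingEnd ℂ z) • v),
      Lp.coeFn_smul (starRingEnd ℂ z) v] with x h1 h2 h3 h4 h5 h6 h7
    rw [h4, Pi.sub_apply, h5, Pi.smul_apply, h6, Pi.sub_apply, h7, Pi.smul_apply, h1, h2, h3]
  have key : ∀ ψ : 𝓢(EuclideanSpace ℝ (Fin d), ℂ),
      ∑ j, Matrix.toEuclideanCLM (𝕜 := ℂ) (γ j)
        ((v : 𝓢'(EuclideanSpace ℝ (Fin d), EuclideanSpace ℂ (Fin n)))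
          (∂_{EuclideanSpace.single j (1 : ℝ)} ψ)) =
        -(w : 𝓢'(EuclideanSpace ℝ (Fin d), EuclideanSpace ℂ (Fin n))) ψ := by
    intro ψ
    have hint : ∀ (g : SpinorL2 d n) (ξ : 𝓢(EuclideanSpace ℝ (Fin d), ℂ)),
        Integrable (fun x => ξ x • g x) volume := fun g ξ =>
      memLp_one_iff_integrable.mp ((Lp.memLp g).smul (ξ.memLp 2 volume))
    have hK : Integrable (fun x => ∑ j, (∂_{EuclideanSpace.single j (1 : ℝ)} ψ) x •
        (matrixAct (γ j) v) x + ψ x • w x) volume :=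
      (integrable_finsetSum _ fun j _ => hint _ _).add (hint _ _)
    rw [← add_eq_zero_iff_eq_neg]
    simp_rw [← toTemperedDistribution_matrixAct_apply, Lp.toTemperedDistribution_apply]
    rw [← integral_finsetSum _ fun j _ => hint _ _,
      ← integral_add (integrable_finsetSum _ fun j _ => hint _ _) (hint _ _)]
    refine ext_inner_left ℂ fun e => ?_
    rw [inner_zero_right, ← integral_inner hK]
    -- The factor φ gives compact support, hence membership in the domain. The conjugate is needed
    -- because pairing with ψ is bilinear, while the inner product is sesquilinear.
    have hθ : ContDiff ℝ 1 fun x => ((φ x : ℂ) * starRingEnd ℂ (ψ x)) • e :=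
      ((Complex.ofRealCLM.contDiff.comp hφ).mul
        ((Complex.conjCLE : ℂ →L[ℝ] ℂ).contDiff.comp (ψ.smooth 1))).smul contDiff_const
    have hθc : HasCompactSupport fun x => ((φ x : ℂ) * starRingEnd ℂ (ψ x)) • e :=
      ((hc.comp_left Complex.ofReal_zero).mul_right).smul_right
    have h0 := hu ⟨_, compactToL2_mem_domain hθ hθc γ hq⟩
    have h1 : inner ℂ u (diracOperator γ q ⟨_, compactToL2_mem_domain hθ hθc γ hq⟩ -
        z • compactToL2 _ hθ.continuous hθc) =
        -Complex.I * starRingEnd ℂ (∫ x, inner ℂ e (∑ j, (∂_{EuclideanSpace.single j (1 : ℝ)} ψ) x •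
        (matrixAct (γ j) v) x + ψ x • w x)) := by
      rw [L2.inner_def, ← integral_conj, ← integral_const_mul]
      have hA : ∀ᵐ x, ∀ j, (matrixAct (γ j) v : SpinorL2 d n) x =
          Matrix.toEuclideanCLM (𝕜 := ℂ) (γ j) (v x) := by
        rw [ae_all_iff]
        exact fun j => coeFn_matrixAct (γ j) v
      refine integral_congr_ae ?_
      filter_upwards [hA, hvx, hwx, coeFn_diracOperator_compactToL2 hθ hθc γ hq,
        coeFn_compactToL2 hθ.continuous hθc,
        Lp.coeFn_sub (diracOperator γ q ⟨_, compactToL2_mem_domain hθ hθc γ hq⟩)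
          (z • compactToL2 _ hθ.continuous hθc),
        Lp.coeFn_smul z (compactToL2 _ hθ.continuous hθc)] with x h2 h3 h4 h5 h6 h7 h8
      rw [h7, Pi.sub_apply, h8, Pi.smul_apply, h5, h6, h4, inner_conj_symm]
      simp only [h2, h3, fderiv_ofReal_mul_conj_smul_apply hφ,
        SchwartzMap.lineDerivOp_apply_eq_fderiv]
      exact inner_dirac_apply (fun j => inner_toEuclideanCLM_left (hγh j)) _ _ _ _ _ _ _ _
    have h9 : inner ℂ u (diracOperator γ q ⟨_, compactToL2_mem_domain hθ hθc γ hq⟩ -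
        z • compactToL2 _ hθ.continuous hθc) = 0 := h0
    rw [h1, mul_eq_zero, or_iff_right (neg_ne_zero.mpr Complex.I_ne_zero),
      map_eq_zero_iff _ (RingHom.injective _)] at h9
    exact h9
  have hmem : v ∈ sobolevH1 d n := mem_sobolevH1_of_dirac hγ key
  have hq' : v ∈ potentialDomain n q := by
    refine (Lp.memLp Q).ae_eq ?_
    filter_upwards [hvx, hQx] with x h1 h2
    rw [h2, h1, smul_smul, Complex.ofReal_mul]
  have hqQ : potentialMul n q ⟨v, hq'⟩ = Q := by
    refine Lp.ext ?_
    filter_upwards [coeFn_potentialMul q ⟨v, hq'⟩, hvx, hQx] with x h1 h2 h3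
    rw [h1, h3, h2, smul_smul, Complex.ofReal_mul]
  have hsum : ∑ j, matrixAct (γ j) (partialDeriv j ⟨v, hmem⟩) = w := by
    refine SpinorL2.toTemperedDistribution_injective ?_
    ext1 ψ
    rw [map_sum, sum_apply]
    simp only [Lp.toTemperedDistributionCLM_apply, toTemperedDistribution_matrixAct_apply,
      partialDeriv_spec, TemperedDistribution.lineDerivOp_apply_apply, map_neg,
      Finset.sum_neg_distrib, key ψ, neg_neg]
  refine ⟨⟨hmem, hq'⟩, ?_⟩
  have h1 := diracOperator_apply γ q ⟨v, ⟨hmem, hq'⟩⟩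
  rw [h1, hqQ, hsum, hw]
  rw [smul_sub, smul_smul, neg_mul, Complex.I_mul_I, neg_neg, one_smul]
  abel

theorem fderiv_comp_inv_smul_apply {φ : EuclideanSpace ℝ (Fin d) → ℝ} (R : ℝ)
    (x v : EuclideanSpace ℝ (Fin d)) :
    fderiv ℝ (fun x => φ (R⁻¹ • x)) x v = R⁻¹ * fderiv ℝ φ (R⁻¹ • x) v := by
  rw [fderiv_comp_smul, smul_apply, smul_eq_mul]

/-- The Dirac operator with a continuous potential is essentially self-adjoint. -/
theorem isEssentiallySelfAdjoint_diracOperator {γ : Fin d → Matrix (Fin n) (Fin n) ℂ}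
    (hγ : ∀ i j, γ i * γ j + γ j * γ i = if i = j then (2 : ℂ) • 1 else 0)
    (hγh : ∀ j, (γ j).IsHermitian) {q : EuclideanSpace ℝ (Fin d) → ℝ} (hq : Continuous q) :
    IsEssentiallySelfAdjoint (diracOperator γ q) := by
  have hsymm := diracOperator_isFormalAdjoint hγh q
  refine LinearPMap.isEssentiallySelfAdjoint_of_ker_eq_bot (dense_diracOperator_domain γ hq)
    hsymm fun z hz u hu => ?_
  have hz1 : |z.im| = 1 := by rcases hz with h | h <;> simp [h]
  set C : ℝ := ∑ j, ‖(matrixAct (γ j) : SpinorL2 d n →L[ℂ] SpinorL2 d n)‖ * ‖u‖ with hC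
  have hbound : ∀ (φ : EuclideanSpace ℝ (Fin d) → ℝ) (hφ : ContDiff ℝ 1 φ)
      (hc : HasCompactSupport φ) (M : ℝ),
      (∀ j x, |fderiv ℝ φ x (EuclideanSpace.single j 1)| ≤ M) →
      ‖compactMul φ hφ.continuous hc u‖ ≤ M * C := by
    intro φ hφ hc M hM
    obtain ⟨h, e⟩ := diracOperator_compactMul hγ hγh hq hu hφ hc
    have h1 := hsymm.abs_im_mul_norm_le (starRingEnd ℂ z) ⟨_, h⟩
    have h2 : ‖diracOperator γ q ⟨_, h⟩ - (starRingEnd ℂ z) • compactMul φ hφ.continuous hc u‖ ≤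
        M * C := by
      rw [e, norm_smul, norm_neg, Complex.norm_I, one_mul, hC, Finset.mul_sum]
      refine (norm_sum_le _ _).trans (Finset.sum_le_sum fun j _ => ?_)
      refine (ContinuousLinearMap.le_opNorm _ _).trans ?_
      have h3 := norm_compactMul_le (continuous_fderiv_real_single hφ j)
        (hc.fderiv_apply ℝ _) u (hM j)
      calc _ ≤ ‖(matrixAct (γ j) : SpinorL2 d n →L[ℂ] SpinorL2 d n)‖ * (M * ‖u‖) := by gcongr
        _ = _ := by ring
    rw [Complex.conj_im, abs_neg, hz1, one_mul] at h1
    exact h1.trans h2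
  -- χ is 1 on the unit ball and vanishes outside radius 2; rescaling by N divides its gradient
  -- bound by N.
  let χ : ContDiffBump (0 : EuclideanSpace ℝ (Fin d)) := ⟨1, 2, one_pos, one_lt_two⟩
  have hχ : ContDiff ℝ 1 χ := χ.contDiff
  obtain ⟨M, hM⟩ := (χ.hasCompactSupport.fderiv ℝ).exists_bound_of_continuous
    (hχ.continuous_fderiv one_ne_zero)
  have hM0 : 0 ≤ M := (norm_nonneg _).trans (hM 0)
  refine eq_zero_of_forall_inner_compactToL2 fun f hf hc => ?_
  obtain ⟨R₀, hR₀⟩ := hc.isCompact.isBounded.subset_closedBall (0 : EuclideanSpace ℝ (Fin d))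
  have hmain : ∀ᶠ N : ℕ in Filter.atTop, ‖inner ℂ (compactToL2 f hf.continuous hc) u‖ ≤
      ‖compactToL2 f hf.continuous hc‖ * (M * C) / N := by
    -- N ≥ R₀ makes the rescaled cutoff equal to 1 on the support of f, so that inserting it does
    -- not change the inner product with u.
    filter_upwards [Filter.eventually_ge_atTop (max 1 ⌈R₀⌉₊)] with N hN
    have hN1 : (0 : ℝ) < N := by exact_mod_cast (le_max_left _ _).trans hN
    have hNR : R₀ ≤ N := (Nat.le_ceil R₀).trans (by exact_mod_cast (le_max_right _ _).trans hN)
    have hφ : ContDiff ℝ 1 fun x => χ ((N : ℝ)⁻¹ • x) := hχ.comp (contDiff_const_smul _)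
    have hφc : HasCompactSupport fun x => χ ((N : ℝ)⁻¹ • x) :=
      χ.hasCompactSupport.comp_smul (inv_ne_zero hN1.ne')
    have h1 := hbound _ hφ hφc ((N : ℝ)⁻¹ * M) fun j x => by
      rw [fderiv_comp_inv_smul_apply, abs_mul, abs_of_pos (inv_pos.mpr hN1)]
      gcongr
      refine ((fderiv ℝ χ ((N : ℝ)⁻¹ • x)).le_opNorm _).trans ?_
      simpa using hM ((N : ℝ)⁻¹ • x)
    have h2 : inner ℂ (compactToL2 f hf.continuous hc) u =
        inner ℂ (compactToL2 f hf.continuous hc) (compactMul _ hφ.continuous hφc u) := by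
      rw [L2.inner_def, L2.inner_def]
      refine integral_congr_ae ?_
      filter_upwards [coeFn_compactToL2 hf.continuous hc, coeFn_compactMul hφ.continuous hφc u]
        with x h3 h4
      rw [h3, h4]
      by_cases hx : f x = 0
      · rw [hx, inner_zero_left, inner_zero_left]
      · have hx' : ‖x‖ ≤ R₀ := by simpa using hR₀ (subset_tsupport f hx)
        have : χ ((N : ℝ)⁻¹ • x) = 1 := by
          refine χ.one_of_mem_closedBall ?_
          rw [mem_closedBall_zero_iff, norm_smul, norm_inv, Real.norm_of_nonneg hN1.le,
            inv_mul_le_iff₀ hN1]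
          change ‖x‖ ≤ N * 1
          linarith
        rw [this, Complex.ofReal_one, one_smul]
    rw [h2]
    calc _ ≤ ‖compactToL2 f hf.continuous hc‖ * ‖compactMul _ hφ.continuous hφc u‖ :=
          norm_inner_le_norm _ _
      _ ≤ ‖compactToL2 f hf.continuous hc‖ * ((N : ℝ)⁻¹ * M * C) := by gcongr
      _ = _ := by field_simp
  have hlim := tendsto_const_div_atTop_nhds_zero_nat
    (‖compactToL2 f hf.continuous hc‖ * (M * C))
  exact norm_le_zero_iff.mp (ge_of_tendsto hlim hmain)

/-! ### Approximate eigenfunctions -/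

theorem norm_sq_eq_integral (f : SpinorL2 d n) : ‖f‖ ^ 2 = ∫ x, ‖f x‖ ^ 2 := by
  have h : (inner ℂ f f : ℂ) = ((∫ x, ‖f x‖ ^ 2 : ℝ) : ℂ) := by
    rw [L2.inner_def, ← integral_complex_ofReal]
    refine integral_congr_ae (.of_forall fun x => ?_)
    simp only
    rw [inner_self_eq_norm_sq_to_K, Complex.ofReal_pow]
    rfl
  rw [inner_self_eq_norm_sq_to_K] at h
  have h' : ((‖f‖ ^ 2 : ℝ) : ℂ) = ((∫ x, ‖f x‖ ^ 2 : ℝ) : ℂ) := by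
    rw [Complex.ofReal_pow]
    exact h
  exact Complex.ofReal_injective h'

/-- A unit vector combination of Dirac matrices has an eigenvalue `s` with `s² = 1`. -/
theorem exists_eigenvector_sum_smul [NeZero n] {γ : Fin d → Matrix (Fin n) (Fin n) ℂ}
    (hγ : ∀ i j, γ i * γ j + γ j * γ i = if i = j then (2 : ℂ) • 1 else 0)
    {k : EuclideanSpace ℝ (Fin d)} (hk : ‖k‖ = 1) :
    ∃ (v : EuclideanSpace ℂ (Fin n)) (s : ℝ), v ≠ 0 ∧ s ^ 2 = 1 ∧
      ∑ j, (k j : ℂ) • Matrix.toEuclideanCLM (𝕜 := ℂ) (γ j) v = (s : ℂ) • v := by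
  set G : Matrix (Fin n) (Fin n) ℂ := ∑ j, (k j : ℂ) • γ j with hG
  have hGG : G * G = 1 := by
    have h1 : G * G = ∑ i, ∑ j, ((k i : ℂ) * k j) • (γ i * γ j) := by
      simp only [hG, Finset.sum_mul_sum, smul_mul_smul_comm]
    have h2 : G * G = ∑ i, ∑ j, ((k i : ℂ) * k j) • (γ j * γ i) := by
      rw [h1, Finset.sum_comm]
      simp only [mul_comm]
    have h3 : (2 : ℂ) • (G * G) = (2 : ℂ) • 1 := by
      rw [two_smul]
      nth_rw 1 [h1]
      rw [h2]
      simp only [← Finset.sum_add_distrib, ← smul_add, hγ]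
      have hk' : ∑ i, (k i : ℂ) * k i = 1 := by
        have := EuclideanSpace.real_norm_sq_eq k
        rw [hk, one_pow] at this
        simp only [sq] at this
        exact_mod_cast this.symm
      simp [← Finset.sum_smul, hk']
    exact smul_right_injective _ (two_ne_zero (α := ℂ)) h3
  set T := Matrix.toEuclideanCLM (𝕜 := ℂ) G with hT
  have hTT : ∀ v, T (T v) = v := by
    intro v
    have := congrArg (fun M => Matrix.toEuclideanCLM (𝕜 := ℂ) M v) hGG
    simp only [map_mul, map_one] at this
    exact this
  have hTs : ∀ v, ∑ j, (k j : ℂ) • Matrix.toEuclideanCLM (𝕜 := ℂ) (γ j) v = T v := by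
    intro v
    rw [hT, hG, map_sum, sum_apply]
    simp only [map_smul, smul_apply]
  obtain ⟨v₀, hv₀⟩ := exists_ne (0 : EuclideanSpace ℂ (Fin n))
  -- As T² = 1, the vector v₀ + Tv₀ is fixed by T; if it vanishes, then Tv₀ = -v₀.
  by_cases h : v₀ + T v₀ = 0
  · refine ⟨v₀, -1, hv₀, by norm_num, ?_⟩
    rw [hTs, eq_neg_of_add_eq_zero_right h]
    simp
  · refine ⟨v₀ + T v₀, 1, h, by norm_num, ?_⟩
    rw [hTs, map_add, hTT]
    simp [add_comm]

/-- Weyl sequences for the Dirac operator: gauging away the potential, a slowly varying cutoff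
of a plane wave is an approximate eigenfunction. -/
theorem exists_approximate_eigenfunction [NeZero n] {γ : Fin d → Matrix (Fin n) (Fin n) ℂ}
    (hγ : ∀ i j, γ i * γ j + γ j * γ i = if i = j then (2 : ℂ) • 1 else 0)
    {η : ℝ → ℝ} (hη : Continuous η) {k : EuclideanSpace ℝ (Fin d)} (hk : ‖k‖ = 1) (t : ℝ)
    {ε : ℝ} (hε : 0 < ε) :
    ∃ f : (diracOperator γ fun x => η (inner ℝ x k)).domain, (f : SpinorL2 d n) ≠ 0 ∧
      ‖diracOperator γ (fun x => η (inner ℝ x k)) f - (t : ℂ) • (f : SpinorL2 d n)‖ ≤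
        ε * ‖(f : SpinorL2 d n)‖ := by
  obtain ⟨v, s, hv, hs, hsv⟩ := exists_eigenvector_sum_smul hγ hk
  set q : EuclideanSpace ℝ (Fin d) → ℝ := fun x => η (inner ℝ x k) with hq_def
  have hq : Continuous q := hη.comp (by fun_prop)
  -- The phase p = exp(i s g(x·k)) gives -iD(pv) = s²(t - q)pv = (t - q)pv, so pv solves the
  -- equation for t exactly, though it is not in L².
  set g : ℝ → ℝ := fun τ => ∫ r in (0 : ℝ)..τ, (t - η r) with hg_def
  have hcont : Continuous fun r => t - η r := by fun_prop
  have hg : ∀ τ, HasDerivAt g (t - η τ) τ := fun τ =>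
    (hcont.integral_hasStrictDerivAt 0 τ).hasDerivAt
  have hgC : ContDiff ℝ 1 g := by
    rw [contDiff_one_iff_deriv]
    refine ⟨fun τ => (hg τ).differentiableAt, ?_⟩
    rw [show deriv g = fun r => t - η r from funext fun τ => (hg τ).deriv]
    exact hcont
  set p : EuclideanSpace ℝ (Fin d) → ℂ :=
    fun x => Complex.exp (Complex.I * ((s * g (inner ℝ x k) : ℝ) : ℂ)) with hp_def
  have hpn : ∀ x, ‖p x‖ = 1 := fun x => by
    simp only [hp_def]
    rw [mul_comm]
    exact Complex.norm_exp_ofReal_mul_I _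
  have hsg : ContDiff ℝ 1 fun x : EuclideanSpace ℝ (Fin d) => s * g (inner ℝ x k) :=
    contDiff_const.mul (hgC.comp (contDiff_id.inner ℝ contDiff_const))
  have hpC : ContDiff ℝ 1 p :=
    (contDiff_const.mul (Complex.ofRealCLM.contDiff.comp hsg)).cexp
  have hpd : ∀ x w, fderiv ℝ p x w =
      p x * (Complex.I * ((s * ((t - q x) * inner ℝ w k) : ℝ) : ℂ)) := by
    intro x w
    have h0 : HasFDerivAt (fun x : EuclideanSpace ℝ (Fin d) => (inner ℝ x k : ℝ))
        (innerSL ℝ k) x := by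
      simp_rw [fun x => real_inner_comm k x]
      exact (innerSL ℝ k).hasFDerivAt
    have h0' := (hg (inner ℝ x k)).comp_hasFDerivAt x h0
    have h1 : HasFDerivAt (fun x : EuclideanSpace ℝ (Fin d) => s * g (inner ℝ x k))
        (s • ((t - q x) • innerSL ℝ k)) x :=
      HasFDerivAt.const_mul (h0' : HasFDerivAt (fun x => g (inner ℝ x k)) _ x) s
    have h2 : HasFDerivAt (fun x => ((s * g (inner ℝ x k) : ℝ) : ℂ))
        (Complex.ofRealCLM.comp (s • ((t - q x) • innerSL ℝ k))) x :=
      Complex.ofRealCLM.hasFDerivAt.comp x h1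
    have h3 : fderiv ℝ p x = _ := (h2.const_mul Complex.I).cexp.fderiv
    rw [h3]
    simp only [smul_apply, ContinuousLinearMap.comp_apply, Complex.ofRealCLM_apply, smul_eq_mul,
      innerSL_apply_apply, real_inner_comm w k, hp_def]
  let χ : ContDiffBump (0 : EuclideanSpace ℝ (Fin d)) := ⟨1, 2, one_pos, one_lt_two⟩
  have hχ : ContDiff ℝ 1 χ := χ.contDiff
  set S : ℝ := ∫ x, ‖χ x‖ ^ 2 with hS
  set D : ℝ := ∫ x, ‖fderiv ℝ χ x‖ ^ 2 with hD
  set B : ℝ := ∑ j, ‖Matrix.toEuclideanCLM (𝕜 := ℂ) (γ j) v‖ with hB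
  have hS0 : 0 < S := by
    refine Continuous.integral_pos_of_hasCompactSupport_nonneg_nonzero (x := 0)
      (by fun_prop) ?_ (fun x => sq_nonneg _) ?_
    · exact χ.hasCompactSupport.comp_left (g := fun r : ℝ => ‖r‖ ^ 2) (by simp)
    · rw [χ.one_of_mem_closedBall (by simp [χ.rIn_pos.le])]
      simp
  have hv0 : 0 < ‖v‖ := norm_pos_iff.mpr hv
  -- The required estimate is B²D/N² ≤ ε²‖v‖²S. A bound linear in N suffices, because N > 1 gives N
  -- ≤ N².
  obtain ⟨N, hN⟩ := exists_nat_gt (max 1 (B ^ 2 * D / (ε ^ 2 * ‖v‖ ^ 2 * S)))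
  have hN1 : (1 : ℝ) < N := (le_max_left _ _).trans_lt hN
  have hN0 : (0 : ℝ) < N := zero_lt_one.trans hN1
  have hNB : B ^ 2 * D ≤ ε ^ 2 * ‖v‖ ^ 2 * S * (N : ℝ) ^ 2 := by
    have h1 := ((le_max_right _ _).trans_lt hN).le
    rw [div_le_iff₀ (by positivity)] at h1
    have h2 : (N : ℝ) ≤ (N : ℝ) ^ 2 := by nlinarith
    calc _ ≤ N * (ε ^ 2 * ‖v‖ ^ 2 * S) := h1
      _ ≤ (N : ℝ) ^ 2 * (ε ^ 2 * ‖v‖ ^ 2 * S) := by gcongr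
      _ = _ := by ring
  set φ : EuclideanSpace ℝ (Fin d) → ℝ := fun x => χ ((N : ℝ)⁻¹ • x) with hφ_def
  have hφ : ContDiff ℝ 1 φ := hχ.comp (contDiff_const_smul _)
  have hφc : HasCompactSupport φ := χ.hasCompactSupport.comp_smul (inv_ne_zero hN0.ne')
  have hf : ContDiff ℝ 1 fun x => ((φ x : ℂ) * p x) • v :=
    ((Complex.ofRealCLM.contDiff.comp hφ).mul hpC).smul contDiff_const
  have hfc : HasCompactSupport fun x => ((φ x : ℂ) * p x) • v :=
    ((hφc.comp_left Complex.ofReal_zero).mul_right).smul_right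
  have hfd : ∀ x w, fderiv ℝ (fun x => ((φ x : ℂ) * p x) • v) x w =
      ((fderiv ℝ φ x w : ℂ) * p x + (φ x : ℂ) * fderiv ℝ p x w) • v := by
    intro x w
    have h1 : HasFDerivAt (fun x => (φ x : ℂ)) (Complex.ofRealCLM.comp (fderiv ℝ φ x)) x :=
      Complex.ofRealCLM.hasFDerivAt.comp x (hφ.differentiable one_ne_zero x).hasFDerivAt
    have h3 : fderiv ℝ (fun x => ((φ x : ℂ) * p x) • v) x = _ :=
      ((h1.mul (hpC.differentiable one_ne_zero x).hasFDerivAt).smul_const v).fderiv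
    rw [h3]
    simp only [ContinuousLinearMap.smulRight_apply, add_apply, smul_apply,
      ContinuousLinearMap.comp_apply, smul_eq_mul, Complex.ofRealCLM_apply]
    congr 1
    ring
  have hmem := compactToL2_mem_domain hf hfc γ hq
  set f := compactToL2 _ hf.continuous hfc with hf_def
  have hfx : f =ᵐ[volume] fun x => ((φ x : ℂ) * p x) • v := coeFn_compactToL2 hf.continuous hfc
  have hnormf : ‖f‖ ^ 2 = ‖v‖ ^ 2 * ((N : ℝ) ^ d * S) := by
    rw [norm_sq_eq_integral]
    have h1 : ∫ x, ‖f x‖ ^ 2 = ∫ x, ‖v‖ ^ 2 * ‖χ ((N : ℝ)⁻¹ • x)‖ ^ 2 := by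
      refine integral_congr_ae ?_
      filter_upwards [hfx] with x hx
      rw [hx, norm_smul, norm_mul, hpn, mul_one, Complex.norm_real, mul_pow, mul_comm]
    rw [h1, integral_const_mul, Measure.integral_comp_inv_smul volume (fun x => ‖χ x‖ ^ 2),
      finrank_euclideanSpace_fin, abs_of_pos (by positivity), smul_eq_mul]
  have hTx : ∀ᵐ x, ‖(diracOperator γ q ⟨f, hmem⟩ - (t : ℂ) • f : SpinorL2 d n) x‖ ^ 2 ≤
      ((N : ℝ)⁻¹ * B) ^ 2 * ‖fderiv ℝ χ ((N : ℝ)⁻¹ • x)‖ ^ 2 := by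
    filter_upwards [hfx, coeFn_diracOperator_compactToL2 hf hfc γ hq,
      Lp.coeFn_sub (diracOperator γ q ⟨f, hmem⟩) ((t : ℂ) • f), Lp.coeFn_smul (t : ℂ) f]
      with x h1 h2 h3 h4
    have h5 : (diracOperator γ q ⟨f, hmem⟩ - (t : ℂ) • f : SpinorL2 d n) x = (-Complex.I * p x) •
        ∑ j, (fderiv ℝ φ x (EuclideanSpace.single j 1) : ℂ) •
          Matrix.toEuclideanCLM (𝕜 := ℂ) (γ j) v := by
      rw [h3, Pi.sub_apply, h4, Pi.smul_apply, h1, h2]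
      have h6 : ∀ j, inner ℝ (EuclideanSpace.single j (1 : ℝ)) k = k j := fun j => by
        simp [EuclideanSpace.inner_single_left]
      have h7 : ∑ j, Matrix.toEuclideanCLM (𝕜 := ℂ) (γ j)
          (fderiv ℝ (fun x => ((φ x : ℂ) * p x) • v) x (EuclideanSpace.single j 1)) =
          p x • ∑ j, (fderiv ℝ φ x (EuclideanSpace.single j 1) : ℂ) •
            Matrix.toEuclideanCLM (𝕜 := ℂ) (γ j) v +
          ((φ x : ℂ) * p x * Complex.I * s * (t - q x)) • ((s : ℂ) • v) := by
        rw [← hsv, Finset.smul_sum, Finset.smul_sum, ← Finset.sum_add_distrib]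
        refine Finset.sum_congr rfl fun j _ => ?_
        rw [hfd, hpd, h6, map_smul, smul_smul, smul_smul, ← add_smul]
        congr 1
        push_cast
        ring
      have hs' : (s : ℂ) ^ 2 = 1 := by exact_mod_cast hs
      rw [h7, smul_add, smul_smul, smul_smul, smul_smul, smul_smul, smul_smul, add_assoc,
        add_sub_assoc,
        ← add_smul, ← sub_smul]
      -- The terms without a derivative of φ cancel because s² = 1; only the gradient of the cutoff
      -- remains.
      rw [show -Complex.I * ((φ x : ℂ) * p x * Complex.I * s * (t - q x)) * s +
        (q x : ℂ) * ((φ x : ℂ) * p x) - (t : ℂ) * ((φ x : ℂ) * p x) = 0 by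
          linear_combination (-(φ x : ℂ) * p x * (t - q x) * s ^ 2) * Complex.I_sq +
            (φ x : ℂ) * p x * (t - q x) * hs', zero_smul, add_zero]
    rw [h5, norm_smul, norm_mul, norm_neg, Complex.norm_I, hpn, one_mul, one_mul, ← mul_pow]
    gcongr
    refine (norm_sum_le _ _).trans ?_
    rw [hB, Finset.mul_sum, Finset.sum_mul]
    refine Finset.sum_le_sum fun j _ => ?_
    rw [norm_smul, Complex.norm_real, hφ_def, fderiv_comp_inv_smul_apply, norm_mul,
      Real.norm_of_nonneg (inv_nonneg.mpr hN0.le), mul_assoc, mul_assoc,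
      mul_comm ‖Matrix.toEuclideanCLM (𝕜 := ℂ) (γ j) v‖]
    gcongr
    refine ((fderiv ℝ χ ((N : ℝ)⁻¹ • x)).le_opNorm _).trans ?_
    simp
  have hnormT : ‖diracOperator γ q ⟨f, hmem⟩ - (t : ℂ) • f‖ ^ 2 ≤
      ((N : ℝ)⁻¹ * B) ^ 2 * ((N : ℝ) ^ d * D) := by
    rw [norm_sq_eq_integral]
    have hint : Integrable (fun x => ((N : ℝ)⁻¹ * B) ^ 2 * ‖fderiv ℝ χ ((N : ℝ)⁻¹ • x)‖ ^ 2)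
        volume := by
      have hc : Continuous fun x : EuclideanSpace ℝ (Fin d) => fderiv ℝ χ ((N : ℝ)⁻¹ • x) :=
        (hχ.continuous_fderiv one_ne_zero).comp (continuous_const_smul _)
      refine Continuous.integrable_of_hasCompactSupport (by fun_prop) ?_
      exact ((χ.hasCompactSupport.fderiv ℝ).comp_smul (inv_ne_zero hN0.ne')).comp_left
        (g := fun L => ((N : ℝ)⁻¹ * B) ^ 2 * ‖L‖ ^ 2) (by simp)
    refine (integral_mono_of_nonneg (.of_forall fun x => sq_nonneg _) hint hTx).trans (le_of_eq ?_)
    rw [integral_const_mul, Measure.integral_comp_inv_smul volume (fun x => ‖fderiv ℝ χ x‖ ^ 2),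
      finrank_euclideanSpace_fin, abs_of_pos (by positivity), smul_eq_mul]
  refine ⟨⟨f, hmem⟩, ?_, ?_⟩
  · have : 0 < ‖f‖ ^ 2 := by rw [hnormf]; positivity
    intro h0
    rw [show f = 0 from h0] at this
    simp at this
  · refine le_of_sq_le_sq ?_ (by positivity)
    refine hnormT.trans ?_
    change _ ≤ (ε * ‖f‖) ^ 2
    rw [mul_pow ε, hnormf]
    have : ((N : ℝ)⁻¹ * B) ^ 2 * ((N : ℝ) ^ d * D) = (N : ℝ) ^ d * ((B ^ 2 * D) / (N : ℝ) ^ 2) := by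
      field_simp
    rw [this]
    have h2 : (B ^ 2 * D) / (N : ℝ) ^ 2 ≤ ε ^ 2 * ‖v‖ ^ 2 * S := by
      rw [div_le_iff₀ (by positivity)]
      exact hNB
    calc _ ≤ (N : ℝ) ^ d * (ε ^ 2 * ‖v‖ ^ 2 * S) := by gcongr
      _ = _ := by ring

/-- The Dirac operator with a potential depending on one coordinate only is essentially
self-adjoint, and the spectrum of its unique self-adjoint extension is the real line. -/
theorem diracOperator_main [NeZero n] {γ : Fin d → Matrix (Fin n) (Fin n) ℂ}
    (hγ : ∀ i j, γ i * γ j + γ j * γ i = if i = j then (2 : ℂ) • 1 else 0)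
    (hγh : ∀ j, (γ j).IsHermitian)
    {η : ℝ → ℝ} (hη : Continuous η) {k : EuclideanSpace ℝ (Fin d)} (hk : ‖k‖ = 1) :
    IsEssentiallySelfAdjoint (diracOperator γ fun x => η (inner ℝ x k)) ∧
      ∃ A : SpinorL2 d n →ₗ.[ℂ] SpinorL2 d n,
        IsSelfAdjoint A ∧ (diracOperator γ fun x => η (inner ℝ x k)) ≤ A ∧
        (∀ B : SpinorL2 d n →ₗ.[ℂ] SpinorL2 d n,
          IsSelfAdjoint B → (diracOperator γ fun x => η (inner ℝ x k)) ≤ B → B = A) ∧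
        unboundedSpectrum A = Set.range ((↑) : ℝ → ℂ) := by
  have h := isEssentiallySelfAdjoint_diracOperator hγ hγh
    (q := fun x => η (inner ℝ x k)) (hη.comp (by fun_prop))
  exact ⟨h, _, h.selfAdjoint_closure, LinearPMap.le_closure _,
    fun B hB hle => LinearPMap.IsEssentiallySelfAdjoint.eq_closure h hB hle,
    LinearPMap.unboundedSpectrum_eq_range_ofReal h fun t ε hε =>
      exists_approximate_eigenfunction hγ hη hk t hε⟩

/-! ### The Pauli and Dirac matrices -/

theorem pauli_isHermitian (j : Fin 3) : (pauli j).IsHermitian := by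
  ext a b
  fin_cases j <;> fin_cases a <;> fin_cases b <;> simp [pauli, Matrix.conjTranspose_apply]

theorem pauli_anticomm (i j : Fin 3) :
    pauli i * pauli j + pauli j * pauli i = if i = j then (2 : ℂ) • 1 else 0 := by
  ext a b
  fin_cases i <;> fin_cases j <;> fin_cases a <;> fin_cases b <;>
    simp [pauli, one_add_one_eq_two]

theorem diracAlpha_eq_reindexAlgEquiv (j : Fin 3) : diracAlpha j =
    Matrix.reindexAlgEquiv ℂ ℂ finSumFinEquiv (Matrix.fromBlocks 0 (pauli j) (pauli j) 0) :=
  rfl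

theorem diracAlpha_isHermitian (j : Fin 3) : (diracAlpha j).IsHermitian := by
  have h : (Matrix.fromBlocks 0 (pauli j) (pauli j) 0).IsHermitian := by
    rw [Matrix.isHermitian_fromBlocks_iff]
    simp [Matrix.IsHermitian, (pauli_isHermitian j).eq]
  exact h.submatrix _

/-- A product of two off-diagonal block matrices is block diagonal with σᵢσⱼ in both blocks, so the
relations are inherited from the Pauli matrices. -/
theorem diracAlpha_anticomm (i j : Fin 3) :
    diracAlpha i * diracAlpha j + diracAlpha j * diracAlpha i =
      if i = j then (2 : ℂ) • 1 else 0 := by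
  simp only [diracAlpha_eq_reindexAlgEquiv]
  rw [← map_mul, ← map_mul, ← map_add, Matrix.fromBlocks_multiply, Matrix.fromBlocks_multiply,
    Matrix.fromBlocks_add]
  simp only [zero_mul, mul_zero, add_zero, zero_add, pauli_anticomm]
  split_ifs
  · rw [← map_one (Matrix.reindexAlgEquiv ℂ ℂ (finSumFinEquiv (m := 2) (n := 2))), ← map_smul,
      ← Matrix.fromBlocks_one, Matrix.fromBlocks_smul, smul_zero]
  · simp

end Spinor

theorem mainTheorem3 (η : ℝ → ℝ) (hη : Continuous η) :
    (∀ k : EuclideanSpace ℝ (Fin 2), ‖k‖ = 1 →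
      IsEssentiallySelfAdjoint (diracH2 fun x => η (inner ℝ x k)) ∧
      ∃ A : SpinorL2 2 2 →ₗ.[ℂ] SpinorL2 2 2,
        IsSelfAdjoint A ∧ (diracH2 fun x => η (inner ℝ x k)) ≤ A ∧
        (∀ B : SpinorL2 2 2 →ₗ.[ℂ] SpinorL2 2 2,
          IsSelfAdjoint B → (diracH2 fun x => η (inner ℝ x k)) ≤ B → B = A) ∧
        unboundedSpectrum A = Set.range ((↑) : ℝ → ℂ)) ∧
    (∀ k : EuclideanSpace ℝ (Fin 3), ‖k‖ = 1 →
      IsEssentiallySelfAdjoint (diracH3 fun x => η (inner ℝ x k)) ∧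
      ∃ A : SpinorL2 3 4 →ₗ.[ℂ] SpinorL2 3 4,
        IsSelfAdjoint A ∧ (diracH3 fun x => η (inner ℝ x k)) ≤ A ∧
        (∀ B : SpinorL2 3 4 →ₗ.[ℂ] SpinorL2 3 4,
          IsSelfAdjoint B → (diracH3 fun x => η (inner ℝ x k)) ≤ B → B = A) ∧
        unboundedSpectrum A = Set.range ((↑) : ℝ → ℂ)) := by
  -- In dimension two the matrices are the first two Pauli matrices; an injective reindexing
  -- preserves the anticommutation relations.
  have h2 : ![pauli 0, pauli 1] = fun j : Fin 2 => pauli j.castSucc := by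
    ext1 j
    fin_cases j <;> rfl
  refine ⟨fun k hk => ?_, fun k hk =>
    diracOperator_main diracAlpha_anticomm diracAlpha_isHermitian hη hk⟩
  refine diracOperator_main (fun i j => ?_) (fun j => ?_) hη hk
  · rw [h2, pauli_anticomm]
    simp only [Fin.castSucc_inj]
  · rw [h2]
    exact pauli_isHermitian _
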